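/- Conventions. The functional graph $\mathcal G(f/S)$ of a map $f:S\to S$ is the directed graph with vertex set $S$ and edges $s\to f(s)$. Rooted trees are finite, with edges directed towards the root. $\bullet$ is the one-vertex tree; for a forest $G=\bigoplus_i T_i$ (disjoint union of rooted trees), $\langle G\rangle$ is the rooted tree whose root has as children exactly the roots of the $T_i$. For trees $\langle G\rangle,\langle H\rangle$ put $\langle G\rangle+\langle H\rangle=\langle G\oplus H\rangle$ and $k\cdot\langle G\rangle=\langle k\times G\rangle$, where $k\times G$ is the disjoint union of $k$ copies of $G$. $\operatorname{Cyc}(m,T)$ is the directed graph consisting of a directed $m$-cycle each of whose vertices is the root of a copy of $T$; $\operatorname{Cyc}(m)=\operatorname{Cyc}(m,\bullet)$ and $\{T\}=\operatorname{Cyc}(1,T)$. For a non-increasing sequence $v=(v_1,\dots,v_d)$ of positive integers, let $T_v^0=\bullet$, $T_v^k=\big\langle v_k\times T_v^{k-1}\oplus\bigoplus_{i=1}^{k-1}(v_i-v_{i+1})\times T_v^{i-1}\big\rangle$ for $1\le k<d$, and $\mathcal T_v=\big\langle (v_d-1)\times T_v^{d-1}\oplus\bigoplus_{i=1}^{d-1}(v_i-v_{i+1})\times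 T_v^{i-1}\big\rangle$. For positive integers $t,n$, let $\gcd_t(n)=(1)$ if $\gcd(t,n)=1$; otherwise $\gcd_t(n)=(n_1,\dots,n_D)$ with $n_1=\gcd(t,n)$, $n_{i+1}=\gcd\big(t,\tfrac{n}{n_1\cdots n_i}\big)$ and $D$ the least positive integer with $n_{D+1}=1$. Let $\varphi$ be Euler's totient function and $\operatorname{ord}_d(t)$ the multiplicative order of $t$ modulo $d$. Statement. Let $t$ be a positive integer, $p$ a prime, $q=p^s\ge 4$, and let $\mathbb G_q=\mathrm{PGL}(2,q)=\mathrm{GL}(2,q)/(\mathbb F_q^*\cdot I)$. Write $q-1=\nu_1\omega_1$ and $q+1=\nu_2\omega_2$, where $\omega_1$ (resp. $\omega_2$) is the greatest divisor of $q-1$ (resp. $q+1$) that is relatively prime to $t$, and put $d_1=\frac{q(q+1)}2$, $d_2=\frac{q(q-1)}2$. Then the functional graph of the map $\mathbb G_q\to\mathbb G_q$, $g\mapsto g^t$, is isomorphic to $$\left(\bigoplus_{i=1,2}\ \bigoplus_{\substack{d\mid\omega_i\\ d\ne1}}\frac{d_i\cdot\varphi(d)}{\operatorname{ord}_d(t)}\times\operatorname{Cyc}\big(\operatorname{ord}_d(t),\mathcal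 T_{\gcd_t(\nu_i)}\big)\right)\oplus\mathcal G,$$ where $$\mathcal G=\Big\{d_1\cdot\mathcal T_{\gcd_t(\nu_1)}+d_2\cdot\mathcal T_{\gcd_t(\nu_2)}+\tfrac{q^2-1}{p-1}\cdot\mathcal T_{(p)}\Big\}\quad\text{if }p\mid t,$$ $$\mathcal G=\frac{q^2-1}{\operatorname{ord}_p(t)}\times\operatorname{Cyc}(\operatorname{ord}_p(t))\ \oplus\ \Big\{d_1\cdot\mathcal T_{\gcd_t(\nu_1)}+d_2\cdot\mathcal T_{\gcd_t(\nu_2)}\Big\}\quad\text{if }p\nmid t.$$ -/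

import Mathlib

open scoped MatrixGroups

namespace PowerMapGraph

/-! ### Finite rooted trees -/

/-- Finite rooted trees. A forest is a list of trees, and `node F` is the rooted tree `⟨F⟩` whose
root has as children the roots of the trees of `F`. -/
inductive RTree : Type
  | node : List RTree → RTree

namespace RTree

/-- The forest `F` with `T = ⟨F⟩`. -/
def forest : RTree → List RTree
  | node F => F

/-- The tree `•` with a unique vertex. -/
def bullet : RTree := node []

/-- The sum of two rooted trees: the two roots are identified. -/
instance : Add RTree := ⟨fun S T => node (S.forest ++ T.forest)⟩

/-- `k • ⟨F⟩ = ⟨k × F⟩`: the roots of `k` copies of the tree are identified. -/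
instance : SMul ℕ RTree := ⟨fun k T => node (List.replicate k T.forest).flatten⟩

/-- The vertices of a rooted tree: the root, and the vertices of the subtrees at its children. -/
inductive Vertex : RTree → Type
  | root (F : List RTree) : Vertex (node F)
  | child {F : List RTree} (i : Fin F.length) (v : Vertex (F.get i)) : Vertex (node F)

/-- The root of a rooted tree. -/
def root : (T : RTree) → Vertex T
  | node F => Vertex.root F

/-- The edges of a rooted tree, directed towards the root. -/
inductive Edge : {T : RTree} → Vertex T → Vertex T → Prop
  | top {F : List RTree} (i : Fin F.length) :
      Edge (Vertex.child i (RTree.root (F.get i))) (Vertex.root F)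
  | child {F : List RTree} (i : Fin F.length) {u v : Vertex (F.get i)} :
      Edge u v → Edge (Vertex.child i u) (Vertex.child i v)

/-- The trees `T^k` attached to a sequence `ν 1, ν 2, …`: `T^0 = •` and
`T^k = ⟨ν k × T^(k-1) ⊕ ⨁_{i=1}^{k-1} (ν i - ν (i+1)) × T^(i-1)⟩`. -/
def level (ν : ℕ → ℕ) : ℕ → RTree
  | 0 => bullet
  | k + 1 => node (List.replicate (ν (k + 1)) (level ν k) ++
      (List.finRange k).flatMap fun i =>
        List.replicate (ν (i.val + 1) - ν (i.val + 2)) (level ν i.val))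
termination_by k => k
decreasing_by all_goals omega

/-- The elementary tree of a non-increasing sequence `v = (ν 1, …, ν d)` of positive integers:
`⟨(ν d - 1) × T^(d-1) ⊕ ⨁_{i=1}^{d-1} (ν i - ν (i+1)) × T^(i-1)⟩`. -/
def elementary (v : List ℕ) : RTree :=
  let ν : ℕ → ℕ := fun k => v.getD (k - 1) 0
  let d := v.length
  node (List.replicate (ν d - 1) (level ν (d - 1)) ++
    (List.finRange (d - 1)).flatMap fun i =>
      List.replicate (ν (i.val + 1) - ν (i.val + 2)) (level ν i.val))

end RTree

/-! ### The iterated gcd -/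

/-- The sequence `ν 1 = gcd (t, n)`, `ν (i+1) = gcd (t, n / (ν 1 ⋯ ν i))`, stopped just before its
first term equal to `1` (`n` is positive in all uses). -/
def gcdSeq (t n : ℕ) : List ℕ :=
  if _h : n = 0 ∨ Nat.gcd t n = 1 then []
  else Nat.gcd t n :: gcdSeq t (n / Nat.gcd t n)
termination_by n
decreasing_by
  have h0 : 0 < n := Nat.pos_of_ne_zero fun e => _h (Or.inl e)
  have hg : 0 < Nat.gcd t n := Nat.gcd_pos_of_pos_right t h0
  exact Nat.div_lt_self h0 (by omega)

/-- The iterated gcd of `n` relative to `t`; it is the sequence `(1)` if `gcd (t, n) = 1`. -/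
def iteratedGcd (t n : ℕ) : List ℕ :=
  if Nat.gcd t n = 1 then [1] else gcdSeq t n

/-! ### Directed graphs -/

/-- The functional graph of `f`: the edges are `x → f x`. -/
def functionalGraph {V : Type*} (f : V → V) : Digraph V where
  Adj x y := f x = y

/-- `Cyc (m, T)`: an `m`-cycle, each vertex of which is the root of a copy of `T`
(`m` is positive in all uses). -/
def Cyc (m : ℕ) (T : RTree) : Digraph (ZMod m × T.Vertex) where
  Adj x y := (x.1 = y.1 ∧ RTree.Edge x.2 y.2) ∨
    (y.1 = x.1 + 1 ∧ x.2 = T.root ∧ y.2 = T.root)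

/-- The disjoint union of two directed graphs. -/
def disjSum {V W : Type*} (G : Digraph V) (H : Digraph W) : Digraph (V ⊕ W) where
  Adj := Sum.LiftRel G.Adj H.Adj

/-- The edges of the disjoint union of a family of directed graphs. -/
inductive UnionAdj {ι : Type*} {V : ι → Type*} (G : (i : ι) → Digraph (V i)) :
    (Σ i, V i) → (Σ i, V i) → Prop
  | mk (i : ι) (x y : V i) : (G i).Adj x y → UnionAdj G ⟨i, x⟩ ⟨i, y⟩

/-- The disjoint union of a family of directed graphs. -/
def disjUnion {ι : Type*} {V : ι → Type*} (G : (i : ι) → Digraph (V i)) :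
    Digraph (Σ i, V i) where
  Adj := UnionAdj G

/-- `k × G`: the disjoint union of `k` copies of `G`. -/
def copies {V : Type*} (k : ℕ) (G : Digraph V) : Digraph (Σ _ : Fin k, V) :=
  disjUnion fun _ => G

/-- Two directed graphs are isomorphic. -/
def Isomorphic {V W : Type*} (G : Digraph V) (H : Digraph W) : Prop :=
  Nonempty (G.Adj ≃r H.Adj)

/-- The multiplicative order of `t` modulo `d`. -/
noncomputable def ord (d t : ℕ) : ℕ := orderOf (t : ZMod d)

/-- `⨁_{d ∣ ω, d ≠ 1} (c φ(d) / ord_d(t)) × Cyc (ord_d(t), T)`. -/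
noncomputable def cycleFamily (c ω t : ℕ) (T : RTree) :=
  disjUnion fun d : {d : ℕ // d ∣ ω ∧ d ≠ 1} =>
    copies (c * Nat.totient d / ord d t) (Cyc (ord d t) T)

end PowerMapGraph

/-! The nontrivial elements of `PGL(2, F)` are partitioned by cyclic subgroups that meet pairwise
only in the identity: split tori of order `q - 1`, nonsplit tori of order `q + 1`, and subgroups of
order `p` generated by unipotents. The power map preserves each of them. A `t`-th root of `x ≠ 1`
lies in the same subgroup as `x`, whereas roots of `1` come from all of them. Hence the graph is the
union of the graphs of these cyclic groups, glued at the identity, where the hanging trees add up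
(`isomorphic_of_partition`).

In a cyclic group of order `n`, the images of the iterated power map have orders `M 0 = n`, `M (i+1)
= M i / gcd (t, M i)`, until the order `ω` is reached, on which the map is bijective. An element has
either no `t`-th root in the `i`-th image or exactly `gcd (t, M i)` of them. Differences of
consecutive counts give the number of roots of each depth, and these are the multiplicities in the
trees `T^k` and in the elementary tree (`IsKernelSeq.map_hangingTree`).

Such local counts suffice because a functional graph whose vertices all reach a cycle is determined
by the map on its cyclic vertices and the trees hanging there (`IsDecorated.isomorphic`).

The partition exists because a nonscalar 2×2 matrix `B` has centralizer `F[B]`, so commuting is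
transitive among nonscalar matrices (`torus_eq_of_mem`). The split tori are counted through
idempotents, the subgroups of order `p` through nilpotents, and the nonsplit tori by subtraction
from the order of the group (`exists_partition`). -/

open scoped MatrixGroups

namespace PowerMapGraph

/-! ### Rooted trees: parents, children and subtrees of a vertex. -/

namespace RTree

/-- The subtree of `T` consisting of a vertex and its descendants. -/
def subtree : {T : RTree} → Vertex T → RTree
  | _, .root F => node F
  | _, .child _ v => subtree v

/-- The inclusion of the subtree at `v`, restricted to the children of its root. -/
def kid : {T : RTree} → (v : Vertex T) → Fin (subtree v).forest.length → Vertex T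
  | _, .root F, j => .child j (root (F.get j))
  | _, .child i v, j => .child i (kid v j)

open Classical in
/-- The parent of a vertex (the root being its own parent). -/
noncomputable def parent : {T : RTree} → Vertex T → Vertex T
  | _, .root F => .root F
  | _, @Vertex.child F i v => if v = root (F.get i) then .root F else .child i (parent v)

theorem subtree_root (T : RTree) : subtree T.root = T := by
  cases T; rfl

/-- Every vertex except the root has one outgoing edge. The condition on `u` is needed because
`parent` fixes the root. -/
theorem edge_iff {T : RTree} (u v : Vertex T) : Edge u v ↔ u ≠ T.root ∧ parent u = v := by
  induction u with
  | root F =>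
    constructor
    · intro h; cases h
    · intro h; exact absurd rfl h.1
  | @child F i w ih =>
    have hne : Vertex.child i w ≠ (node F).root := by
      intro h; cases h
    constructor
    · intro h
      refine ⟨hne, ?_⟩
      cases h with
      | top => simp [parent]
      | child _ h =>
        obtain ⟨h1, h2⟩ := (ih _).1 h
        simp only [parent, h1, h2, if_false]
    · rintro ⟨-, h⟩
      by_cases hw : w = (F.get i).root
      · subst hw
        simp only [parent, if_true] at h
        subst h
        exact Edge.top i
      · simp only [parent, hw, if_false] at h
        subst h
        exact Edge.child i ((ih _).2 ⟨hw, rfl⟩)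

theorem subtree_kid {T : RTree} (v : Vertex T) (j : Fin (subtree v).forest.length) :
    subtree (kid v j) = (subtree v).forest.get j := by
  induction v with
  | root F => exact subtree_root _
  | child i w ih => exact ih j

theorem edge_kid {T : RTree} (v : Vertex T) (j : Fin (subtree v).forest.length) :
    Edge (kid v j) v := by
  induction v with
  | root F => exact Edge.top j
  | child i w ih => exact Edge.child i (ih j)

theorem kid_injective {T : RTree} (v : Vertex T) : Function.Injective (kid v) := by
  induction v with
  | root F =>
    intro j k h
    injection h
  | child i w ih =>
    intro j k h
    simp only [kid, Vertex.child.injEq, heq_eq_eq, true_and] at h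
    exact ih h

theorem exists_kid {T : RTree} {u v : Vertex T} (h : Edge u v) : ∃ j, kid v j = u := by
  induction h with
  | top i => exact ⟨i, rfl⟩
  | child i _ ih =>
    obtain ⟨j, rfl⟩ := ih
    exact ⟨j, rfl⟩

theorem exists_iterate_parent {T : RTree} (u : Vertex T) : ∃ n, parent^[n] u = T.root := by
  induction u with
  | root F => exact ⟨0, rfl⟩
  | @child F i w ih =>
    obtain ⟨n, hn⟩ := ih
    induction n generalizing w with
    | zero =>
      refine ⟨1, ?_⟩
      have : w = (F.get i).root := hn
      subst this
      simp [parent, root]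
    | succ n ih =>
      by_cases hw : w = (F.get i).root
      · refine ⟨1, ?_⟩
        subst hw
        simp [parent, root]
      · obtain ⟨k, hk⟩ := ih (parent w) hn
        refine ⟨k + 1, ?_⟩
        rw [Function.iterate_succ_apply]
        simpa only [parent, hw, if_false] using hk

end RTree

/-! ### Functional graphs described by cycles and hanging trees. -/

/-- `G` is the functional graph of `f`, its vertices on cycles are parametrized by `a : A → V`, `f`
acts on them as `r`, and `c x` is the tree of the vertices which reach `x` off the cycles. -/
structure IsDecorated {V A : Type*} (G : Digraph V) (f : V → V) (a : A → V) (r : A → A)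
    (c : V → RTree) : Prop where
  adj_iff : ∀ x y, G.Adj x y ↔ f x = y
  injective : Function.Injective a
  map_cyclic : ∀ z, f (a z) = a (r z)
  eventually : ∀ x, ∃ n, f^[n] x ∈ Set.range a
  preimages : ∀ x, ∃ k : Fin (c x).forest.length → V, Function.Injective k ∧
    (∀ y, (∃ j, k j = y) ↔ f y = x ∧ y ∉ Set.range a) ∧ ∀ j, c (k j) = (c x).forest.get j

section Isomorphism

variable {V W A : Type*} {G : Digraph V} {H : Digraph W} {f : V → V} {g : W → W} {a : A → V}
  {b : A → W} {r : A → A} {c : V → RTree} {c' : W → RTree}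

/-- Every vertex reaches a cycle in finitely many steps, so a property can be propagated backwards
along `f` from the cycles. -/
theorem IsDecorated.induction (h : IsDecorated G f a r c) {P : V → Prop}
    (cyc : ∀ z, P (a z)) (step : ∀ x, x ∉ Set.range a → P (f x) → P x) (x : V) : P x := by
  obtain ⟨n, hn⟩ := h.eventually x
  induction n generalizing x with
  | zero => obtain ⟨z, rfl⟩ := hn; exact cyc z
  | succ n ih =>
    by_cases hx : x ∈ Set.range a
    · obtain ⟨z, rfl⟩ := hx; exact cyc z
    · exact step x hx (ih _ hn)

theorem IsDecorated.wellFounded (h : IsDecorated G f a r c) :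
    WellFounded fun x y => y ∉ Set.range a ∧ f y = x := by
  refine ⟨fun x => ?_⟩
  refine h.induction (P := Acc _) (fun z => ⟨_, fun y hy => absurd ⟨z, rfl⟩ hy.1⟩) ?_ x
  rintro x - hx
  exact ⟨_, fun y hy => hy.2 ▸ hx⟩

theorem IsDecorated.exists_equiv (h : IsDecorated G f a r c) (x : V) :
    ∃ e : Fin (c x).forest.length ≃ {u // f u = x ∧ u ∉ Set.range a},
      ∀ j, c (e j).1 = (c x).forest.get j := by
  obtain ⟨k, hk, hr, hc⟩ := h.preimages x
  exact ⟨Equiv.ofBijective (fun j => ⟨k j, (hr _).1 ⟨j, rfl⟩⟩)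
    ⟨fun i j hij => hk (Subtype.ext_iff.1 hij), fun y => by
      obtain ⟨j, hj⟩ := (hr _).2 y.2
      exact ⟨j, Subtype.ext hj⟩⟩, hc⟩

/-- Both sets of off-cycle preimages are enumerated by the same list of subtrees; matching equal
positions preserves the tree at each preimage. -/
theorem IsDecorated.exists_local (h : IsDecorated G f a r c) (h' : IsDecorated H g b r c')
    (x : V) (y : W) (hxy : c x = c' y) :
    ∃ e : {u // f u = x ∧ u ∉ Set.range a} ≃ {u // g u = y ∧ u ∉ Set.range b},
      ∀ u, c u.1 = c' (e u).1 := by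
  obtain ⟨e, he⟩ := h.exists_equiv x
  obtain ⟨e', he'⟩ := h'.exists_equiv y
  refine ⟨e.symm.trans ((finCongr (by rw [hxy])).trans e'), fun u => ?_⟩
  obtain ⟨j, rfl⟩ := e.surjective u
  simp only [Equiv.trans_apply, Equiv.symm_apply_apply, he, he']
  simp only [List.get_eq_getElem, finCongr_apply, Fin.val_cast, hxy]

/-- The cyclic parts correspond through `A`, with the same `r` on both sides. The matching is then
extended outwards one preimage layer at a time, the equality of trees being what allows the next
layer to be matched. -/
theorem IsDecorated.isomorphic (h : IsDecorated G f a r c) (h' : IsDecorated H g b r c')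
    (hc : ∀ z, c (a z) = c' (b z)) : Isomorphic G H := by
  classical
  choose e he using h.exists_local h'
  -- The recursion carries the equality of trees along with the image, since matching the preimages
  -- of `f x` needs it. The choice on a cycle is harmless by injectivity of `a`.
  let F : (x : V) → {y : W // c x = c' y} := h.wellFounded.fix fun x ih =>
    if hx : x ∈ Set.range a then ⟨b hx.choose, by rw [← hc, hx.choose_spec]⟩
    else ⟨(e (f x) (ih (f x) ⟨hx, rfl⟩).1 (ih (f x) ⟨hx, rfl⟩).2 ⟨x, rfl, hx⟩).1,
      he _ _ _ ⟨x, rfl, hx⟩⟩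
  have Fcyc : ∀ z, (F (a z)).1 = b z := by
    intro z
    have hx : a z ∈ Set.range a := ⟨z, rfl⟩
    have : (F (a z)).1 = b hx.choose := by
      simp only [F]
      rw [WellFounded.fix_eq, dif_pos hx]
    rw [this, h.injective hx.choose_spec]
  have Fstep : ∀ x (hx : x ∉ Set.range a),
      (F x).1 = (e (f x) (F (f x)).1 (F (f x)).2 ⟨x, rfl, hx⟩).1 := by
    intro x hx
    conv_lhs => simp only [F]
    rw [WellFounded.fix_eq, dif_neg hx]
  have Fmem : ∀ x, (F x).1 ∈ Set.range b ↔ x ∈ Set.range a := by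
    intro x
    constructor
    · intro hx
      by_contra hxa
      rw [Fstep x hxa] at hx
      exact (e (f x) (F (f x)).1 (F (f x)).2 ⟨x, rfl, hxa⟩).2.2 hx
    · rintro ⟨z, rfl⟩
      exact ⟨z, (Fcyc z).symm⟩
  have Fcomm : ∀ x, g (F x).1 = (F (f x)).1 := by
    intro x
    by_cases hx : x ∈ Set.range a
    · obtain ⟨z, rfl⟩ := hx
      rw [Fcyc, h'.map_cyclic, h.map_cyclic, Fcyc]
    · rw [Fstep x hx]
      exact (e (f x) (F (f x)).1 (F (f x)).2 ⟨x, rfl, hx⟩).2.1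
  have Finj : Function.Injective fun x => (F x).1 := by
    intro x
    refine h.induction (P := fun x => ∀ x', (F x).1 = (F x').1 → x = x') ?_ ?_ x
    · intro z x' hx'
      have : x' ∈ Set.range a := (Fmem x').1 (hx' ▸ (Fmem _).2 ⟨z, rfl⟩)
      obtain ⟨z', rfl⟩ := this
      rw [Fcyc, Fcyc] at hx'
      rw [h'.injective hx']
    · intro x hx ih x' hx'
      have hxa : x' ∉ Set.range a := fun hh => hx ((Fmem x).1 (hx' ▸ (Fmem x').2 hh))
      have hf : f x = f x' := ih _ (by rw [← Fcomm, ← Fcomm, hx'])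
      rw [Fstep x hx, Fstep x' hxa] at hx'
      -- The local bijections are indexed by their base point, so `f x = f x'` has to be eliminated
      -- with that point generalized before injectivity applies.
      have key : ∀ (u v : V) (huv : u = v) (hu : f x = u) (hv : f x' = v),
          (e u (F u).1 (F u).2 ⟨x, hu, hx⟩).1 = (e v (F v).1 (F v).2 ⟨x', hv, hxa⟩).1 →
            x = x' := by
        rintro u _ rfl hu hv heq
        exact congrArg Subtype.val ((e u (F u).1 (F u).2).injective (Subtype.ext heq))
      exact key _ _ hf rfl rfl hx'
  have Fsurj : Function.Surjective fun x => (F x).1 := by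
    intro y
    refine h'.induction (P := fun y => ∃ x, (F x).1 = y) (fun z => ⟨a z, Fcyc z⟩) ?_ y
    rintro y hy ⟨x, hx⟩
    obtain ⟨⟨u, hu, hua⟩, heq⟩ := (e x (F x).1 (F x).2).surjective ⟨y, hx.symm, hy⟩
    subst hu
    exact ⟨u, by rw [Fstep u hua, heq]⟩
  refine ⟨⟨Equiv.ofBijective _ ⟨Finj, Fsurj⟩, ?_⟩⟩
  intro x y
  rw [h.adj_iff, h'.adj_iff]
  change g (F x).1 = (F y).1 ↔ _
  rw [Fcomm]
  exact ⟨fun hh => Finj hh, fun hh => by rw [hh]⟩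

end Isomorphism

/-! ### Cycles with trees and disjoint unions as decorated graphs. -/

section Combinators

theorem IsDecorated.disjSum {V W A B : Type*} {G : Digraph V} {H : Digraph W} {f : V → V}
    {g : W → W} {a : A → V} {b : B → W} {r : A → A} {r' : B → B} {c : V → RTree} {c' : W → RTree}
    (h : IsDecorated G f a r c) (h' : IsDecorated H g b r' c') :
    IsDecorated (disjSum G H) (Sum.map f g) (Sum.map a b) (Sum.map r r') (Sum.elim c c') where
  adj_iff := by
    rintro (x | x) (y | y) <;> simp [PowerMapGraph.disjSum, h.adj_iff, h'.adj_iff]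
  injective := h.injective.sumMap h'.injective
  map_cyclic := by
    rintro (z | z) <;> simp [h.map_cyclic, h'.map_cyclic]
  eventually := by
    rintro (x | x)
    · obtain ⟨n, z, hz⟩ := h.eventually x
      refine ⟨n, Sum.inl z, ?_⟩
      have := (Function.Semiconj.iterate_right (f := Sum.inl) (ga := f) (gb := Sum.map f g)
        (fun _ => rfl) n) x
      rw [← this, ← hz]; rfl
    · obtain ⟨n, z, hz⟩ := h'.eventually x
      refine ⟨n, Sum.inr z, ?_⟩
      have := (Function.Semiconj.iterate_right (f := Sum.inr) (ga := g) (gb := Sum.map f g)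
        (fun _ => rfl) n) x
      rw [← this, ← hz]; rfl
  preimages := by
    rintro (x | x)
    · obtain ⟨k, hk, hr, hc⟩ := h.preimages x
      refine ⟨fun j => Sum.inl (k j), Sum.inl_injective.comp hk, ?_, hc⟩
      rintro (y | y)
      · simpa using hr y
      · simp
    · obtain ⟨k, hk, hr, hc⟩ := h'.preimages x
      refine ⟨fun j => Sum.inr (k j), Sum.inr_injective.comp hk, ?_, hc⟩
      rintro (y | y)
      · simp
      · simpa using hr y

theorem IsDecorated.disjUnion {ι : Type*} {V A : ι → Type*} {G : (i : ι) → Digraph (V i)}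
    {f : ∀ i, V i → V i} {a : ∀ i, A i → V i} {r : ∀ i, A i → A i} {c : ∀ i, V i → RTree}
    (h : ∀ i, IsDecorated (G i) (f i) (a i) (r i) (c i)) :
    IsDecorated (disjUnion G) (Sigma.map id f) (Sigma.map id a) (Sigma.map id r)
      (fun x => c x.1 x.2) where
  adj_iff := by
    rintro ⟨i, x⟩ ⟨j, y⟩
    constructor
    · rintro ⟨_, _, _, hxy⟩
      rw [(h i).adj_iff] at hxy
      subst hxy; rfl
    · intro hxy
      cases hxy
      exact ⟨_, _, _, ((h i).adj_iff _ _).2 rfl⟩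
  injective := Function.Injective.sigma_map Function.injective_id fun i => (h i).injective
  map_cyclic := by
    rintro ⟨i, z⟩
    simp [Sigma.map, (h i).map_cyclic]
  eventually := by
    rintro ⟨i, x⟩
    obtain ⟨n, z, hz⟩ := (h i).eventually x
    refine ⟨n, ⟨i, z⟩, ?_⟩
    have := (Function.Semiconj.iterate_right (f := Sigma.mk i) (ga := f i) (gb := Sigma.map id f)
      (fun _ => rfl) n) x
    rw [← this, ← hz]; rfl
  preimages := by
    rintro ⟨i, x⟩
    obtain ⟨k, hk, hr, hc⟩ := (h i).preimages x
    refine ⟨fun j => ⟨i, k j⟩, sigma_mk_injective.comp hk, ?_, hc⟩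
    rintro ⟨i', y⟩
    constructor
    · rintro ⟨j, hj⟩
      cases hj
      obtain ⟨h1, h2⟩ := (hr _).1 ⟨j, rfl⟩
      refine ⟨by simp [Sigma.map, h1], ?_⟩
      rintro ⟨⟨i', z⟩, hz⟩
      obtain ⟨rfl, hz⟩ := Sigma.mk.inj_iff.1 hz
      exact h2 ⟨z, eq_of_heq hz⟩
    · rintro ⟨h1, h2⟩
      obtain ⟨rfl, h1⟩ := Sigma.mk.inj_iff.1 h1
      obtain ⟨j, hj⟩ := (hr y).2 ⟨eq_of_heq h1, fun ⟨z, hz⟩ => h2 ⟨⟨_, z⟩, by rw [← hz]; rfl⟩⟩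
      exact ⟨j, congrArg (Sigma.mk i') hj⟩

open Classical in
/-- The map whose functional graph is `Cyc m T`. -/
noncomputable def cycMap (m : ℕ) (T : RTree) (x : ZMod m × T.Vertex) : ZMod m × T.Vertex :=
  if x.2 = T.root then (x.1 + 1, T.root) else (x.1, RTree.parent x.2)

theorem isDecorated_cyc (m : ℕ) (T : RTree) :
    IsDecorated (Cyc m T) (cycMap m T) (fun z => (z, T.root)) (fun z => z + 1)
      (fun x => RTree.subtree x.2) where
  adj_iff := by
    rintro ⟨i, u⟩ ⟨j, v⟩
    simp only [Cyc, cycMap, RTree.edge_iff]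
    split_ifs with hu
    · simp [hu, eq_comm]
    · simp [hu]
  injective := fun x y hxy => (Prod.ext_iff.1 hxy).1
  map_cyclic := fun z => by simp [cycMap]
  eventually := by
    rintro ⟨i, u⟩
    obtain ⟨n, hn⟩ := RTree.exists_iterate_parent u
    induction n generalizing u with
    | zero => exact ⟨0, i, by simpa using hn.symm⟩
    | succ n ih =>
      by_cases hu : u = T.root
      · exact ⟨0, i, by simp [hu]⟩
      · obtain ⟨k, hk⟩ := ih (RTree.parent u) hn
        exact ⟨k + 1, by simpa [cycMap, hu] using hk⟩
  preimages := by
    rintro ⟨i, v⟩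
    have hroot : ∀ y : ZMod m × T.Vertex,
        y ∉ Set.range (fun z : ZMod m => (z, T.root)) ↔ y.2 ≠ T.root := by
      rintro ⟨j, y⟩
      simp [eq_comm]
    refine ⟨fun j => (i, RTree.kid v j), fun j k hjk => RTree.kid_injective v (by simpa using hjk),
      ?_, RTree.subtree_kid v⟩
    rintro ⟨i', y⟩
    rw [hroot]
    constructor
    · rintro ⟨j, hj⟩
      obtain ⟨rfl, rfl⟩ := Prod.ext_iff.1 hj
      have := (RTree.edge_iff _ _).1 (RTree.edge_kid v j)
      exact ⟨by simp [cycMap, this.1, this.2], this.1⟩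
    · rintro ⟨h1, h2⟩
      simp only [ne_eq] at h2
      simp only [cycMap, h2, if_false, Prod.mk.injEq] at h1
      obtain ⟨k, rfl⟩ := RTree.exists_kid ((RTree.edge_iff y v).2 ⟨h2, h1.2⟩)
      exact ⟨k, by rw [h1.1]⟩

end Combinators

/-! ### Permutations all of whose cycles have the same length -/

/-- Pick a representative of each orbit; its first `m` iterates are distinct and exhaust the orbit,
so orbits times `ZMod m` is in bijection with `X`, which also gives the number of orbits. -/
theorem exists_equiv_cycles {X : Type*} [Finite X] (f : X → X) (m : ℕ) (hm : 0 < m)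
    (hf : ∀ x, Function.minimalPeriod f x = m) (k : ℕ) (hk : k = Nat.card X / m) :
    ∃ e : (Σ _ : Fin k, ZMod m) ≃ X, ∀ j z, e ⟨j, z + 1⟩ = f (e ⟨j, z⟩) := by
  classical
  have : NeZero m := ⟨hm.ne'⟩
  have hper : ∀ x l, f^[l % m] x = f^[l] x := by
    intro x l
    have := Function.iterate_mod_minimalPeriod_eq (f := f) (x := x) (n := l)
    rwa [hf] at this
  let S : Setoid X :=
    { r := fun x y => ∃ l, f^[l] x = y
      iseqv := by
        refine ⟨fun x => ⟨0, rfl⟩, ?_, ?_⟩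
        · rintro x _ ⟨l, rfl⟩
          -- Applying `f` a further `m * l - l` times makes `m * l` in all, a multiple of the common
          -- period.
          refine ⟨m * l - l, ?_⟩
          rw [← Function.iterate_add_apply, Nat.sub_add_cancel (Nat.le_mul_of_pos_left l hm),
            ← hper]
          simp
        · rintro x _ _ ⟨l, rfl⟩ ⟨l', rfl⟩
          exact ⟨l' + l, Function.iterate_add_apply _ _ _ _⟩ }
  let F : Quotient S × ZMod m → X := fun a => f^[a.2.val] a.1.out
  have hF : Function.Bijective F := by
    constructor
    · rintro ⟨x, a⟩ ⟨y, b⟩ hab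
      have hx : Quotient.mk S (F (x, a)) = x := by
        rw [← Quotient.out_eq x]
        exact Quotient.sound (Setoid.symm ⟨a.val, by simp [F]⟩)
      have hy : Quotient.mk S (F (y, b)) = y := by
        rw [← Quotient.out_eq y]
        exact Quotient.sound (Setoid.symm ⟨b.val, by simp [F]⟩)
      have hxy : x = y := by rw [← hx, ← hy, hab]
      subst hxy
      have hv := (Function.iterate_eq_iterate_iff_of_lt_minimalPeriod (f := f) (x := x.out)
        (by rw [hf]; exact ZMod.val_lt a) (by rw [hf]; exact ZMod.val_lt b)).1 hab
      exact congrArg (Prod.mk x) (ZMod.val_injective m hv)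
    · intro x
      obtain ⟨l, hl⟩ := Quotient.exact (Quotient.out_eq (Quotient.mk S x))
      refine ⟨(Quotient.mk S x, (l : ZMod m)), ?_⟩
      simp only [F, ZMod.val_natCast, hper, hl]
  have hcard : Nat.card (Quotient S) = k := by
    have h1 := Nat.card_congr (Equiv.ofBijective F hF)
    rw [Nat.card_prod, Nat.card_zmod] at h1
    rw [hk, ← h1, Nat.mul_div_cancel _ hm]
  let e₀ : Quotient S ≃ Fin k := Finite.equivFinOfCardEq hcard
  refine ⟨(Equiv.sigmaEquivProd _ _).trans
    ((Equiv.prodCongr e₀.symm (Equiv.refl _)).trans (Equiv.ofBijective F hF)), ?_⟩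
  intro j z
  change f^[(z + 1).val] _ = f (f^[z.val] _)
  rw [← Function.iterate_succ_apply' f, ← hper _ (z.val.succ)]
  congr 1
  have : z + 1 = ((z.val + 1 : ℕ) : ZMod m) := by simp
  rw [this, ZMod.val_natCast]

/-! ### The orders of the images of the iterated power map on a cyclic group -/

/-- The order of the image of the `t`-th power map on a cyclic group of order `m`. -/
def powImageCard (t m : ℕ) : ℕ := m / Nat.gcd t m

theorem powImageCard_dvd (t m : ℕ) : powImageCard t m ∣ m :=
  Nat.div_dvd_of_dvd (Nat.gcd_dvd_right t m)

theorem powImageCard_pos (t : ℕ) {m : ℕ} (hm : 0 < m) : 0 < powImageCard t m :=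
  Nat.div_pos (Nat.le_of_dvd hm (Nat.gcd_dvd_right t m)) (Nat.gcd_pos_of_pos_right t hm)

theorem iterate_powImageCard_pos (t : ℕ) {m : ℕ} (hm : 0 < m) (i : ℕ) :
    0 < (powImageCard t)^[i] m := by
  induction i with
  | zero => exact hm
  | succ i ih => rw [Function.iterate_succ_apply']; exact powImageCard_pos t ih

theorem iterate_powImageCard_dvd (t m : ℕ) {i j : ℕ} (hij : i ≤ j) :
    (powImageCard t)^[j] m ∣ (powImageCard t)^[i] m := by
  induction j, hij using Nat.le_induction with
  | base => exact dvd_rfl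
  | succ j _ ih => rw [Function.iterate_succ_apply']; exact (powImageCard_dvd _ _).trans ih

/-- A factor coprime to `t` does not affect the gcd with `t`, so it is carried along unchanged. -/
theorem iterate_powImageCard_mul (t m ω : ℕ) (hω : Nat.Coprime t ω) (i : ℕ) :
    (powImageCard t)^[i] (m * ω) = (powImageCard t)^[i] m * ω := by
  induction i with
  | zero => rfl
  | succ i ih =>
    rw [Function.iterate_succ_apply', Function.iterate_succ_apply', ih]
    simp only [powImageCard]
    rw [Nat.Coprime.gcd_mul_right_cancel_right _ hω.symm, Nat.div_mul_right_comm (Nat.gcd_dvd_right _ _)]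

theorem gcdSeq_spec (t : ℕ) (m : ℕ) (hm : 0 < m) :
    (∀ i < (gcdSeq t m).length, (gcdSeq t m).getD i 0 = Nat.gcd t ((powImageCard t)^[i] m)) ∧
      Nat.Coprime t ((powImageCard t)^[(gcdSeq t m).length] m) := by
  induction m using Nat.strong_induction_on with
  | _ m ih =>
    rw [gcdSeq]
    split_ifs with h
    · rcases h with h | h
      · omega
      · simpa using h
    · push Not at h
      have hg : 0 < Nat.gcd t m := Nat.gcd_pos_of_pos_right t hm
      obtain ⟨h1, h2⟩ := ih (m / Nat.gcd t m) (Nat.div_lt_self hm (by omega))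
        (powImageCard_pos t hm)
      refine ⟨?_, h2⟩
      rintro (_ | i) hi
      · rfl
      · rw [Function.iterate_succ_apply]
        exact h1 i (by simpa using hi)

/-- `v` lists the orders of the kernels of the `t`-th power map on the images of its iterates on a
cyclic group of order `n`, up to the periodic part, which has order `ω`. -/
structure IsKernelSeq (t n ω : ℕ) (v : List ℕ) : Prop where
  pos : 0 < n
  length_pos : 0 < v.length
  getD_eq : ∀ i < v.length, v.getD i 0 = Nat.gcd t ((powImageCard t)^[i] n)
  iterate_eq : (powImageCard t)^[v.length] n = ω
  coprime : Nat.Coprime t ω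

theorem isKernelSeq_iteratedGcd {t n ν ω : ℕ} (hn : 0 < n) (h : n = ν * ω)
    (hω : IsGreatest {d : ℕ | d ∣ n ∧ Nat.Coprime d t} ω) :
    IsKernelSeq t n ω (iteratedGcd t ν) := by
  have hν : 0 < ν := Nat.pos_of_ne_zero (by rintro rfl; simp at h; omega)
  have hω0 : 0 < ω := Nat.pos_of_ne_zero (by rintro rfl; simp at h; omega)
  have hcop : Nat.Coprime t ω := hω.1.2.symm
  -- Once the iterate of `ν` is coprime to `t`, its product with `ω` is again a divisor of `n`
  -- coprime to `t`; maximality of `ω` forces that iterate to be `1`.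
  have key : ∀ i, Nat.Coprime t ((powImageCard t)^[i] ν) → (powImageCard t)^[i] ν = 1 := by
    intro i hi
    have h1 : (powImageCard t)^[i] ν * ω ≤ ω := hω.2 ⟨h ▸ Nat.mul_dvd_mul_right
      (iterate_powImageCard_dvd t ν (Nat.zero_le i)) ω, (hi.mul_right hcop).symm⟩
    have h2 := iterate_powImageCard_pos t hν i
    nlinarith
  have hgcd : ∀ i, Nat.gcd t ((powImageCard t)^[i] n) = Nat.gcd t ((powImageCard t)^[i] ν) := by
    intro i
    rw [h, iterate_powImageCard_mul t ν ω hcop, Nat.Coprime.gcd_mul_right_cancel_right _ hcop.symm]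
  refine ⟨hn, ?_, ?_, ?_, hcop⟩
  · unfold iteratedGcd
    split_ifs with h1
    · simp
    · rw [gcdSeq, dif_neg (by omega)]
      simp
  · intro i hi
    rw [hgcd]
    unfold iteratedGcd at hi ⊢
    split_ifs with h1
    · rw [if_pos h1] at hi
      obtain rfl : i = 0 := by simpa using hi
      exact h1.symm
    · rw [if_neg h1] at hi
      exact (gcdSeq_spec t ν hν).1 i hi
  · rw [h, iterate_powImageCard_mul t ν ω hcop, key, one_mul]
    unfold iteratedGcd
    split_ifs with h1
    · have h2 : ν = 1 := key 0 h1
      subst h2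
      simp [powImageCard]
    · exact (gcdSeq_spec t ν hν).2

/-! ### Depth of an element under the iterated power map. -/

section Depth

variable {t n ω : ℕ} {v : List ℕ}

/-- The largest `i ≤ D` such that the elements of order `o` are `t ^ i`-th powers in a cyclic group
of order `n`. -/
def powDepth (t n D o : ℕ) : ℕ :=
  Nat.findGreatest (fun i => o ∣ (powImageCard t)^[i] n) D

theorem le_powDepth_iff {t n D o i : ℕ} (ho : o ∣ n) (hi : i ≤ D) :
    i ≤ powDepth t n D o ↔ o ∣ (powImageCard t)^[i] n := by
  constructor
  · intro h
    have : o ∣ (powImageCard t)^[powDepth t n D o] n :=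
      Nat.findGreatest_spec (P := fun i => o ∣ (powImageCard t)^[i] n) (Nat.zero_le D) ho
    exact this.trans (iterate_powImageCard_dvd t n h)
  · exact fun h => Nat.le_findGreatest hi h

/-- The tree hanging at an element of order `o` of a cyclic group of order `n`. -/
def hangingTree (t n ω : ℕ) (v : List ℕ) (o : ℕ) : RTree :=
  if o ∣ ω then RTree.elementary v
  else RTree.level (fun k => v.getD (k - 1) 0) (powDepth t n v.length o)

theorem IsKernelSeq.dvd (h : IsKernelSeq t n ω v) : ω ∣ n :=
  h.iterate_eq ▸ iterate_powImageCard_dvd t n (Nat.zero_le _)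

end Depth

/-! ### Preimages under the power map in a cyclic group -/

/-- With a generator `g`, this is a linear congruence on exponents, solved by Bézout inside the
subgroup of elements killed by `m`. -/
theorem IsCyclic.exists_pow_eq {C : Type*} [CommGroup C] [Finite C] [IsCyclic C] (t m : ℕ)
    (hm : m ∣ Nat.card C) (x : C) (hx : x ^ powImageCard t m = 1) :
    ∃ y : C, y ^ t = x ∧ y ^ m = 1 := by
  obtain ⟨g, hg⟩ := IsCyclic.exists_generator (α := C)
  have hgo : orderOf g = Nat.card C := orderOf_eq_card_of_forall_mem_zpowers hg
  obtain ⟨e, he⟩ := hm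
  have hcard : 0 < Nat.card C := Nat.card_pos
  have hm0 : 0 < m := Nat.pos_of_ne_zero (by rintro rfl; simp at he; omega)
  obtain ⟨a, rfl⟩ : ∃ a : ℕ, g ^ a = x := by
    have := (mem_powers_iff_mem_zpowers).2 (hg x)
    exact this
  -- Here `|C| = m * e`; the hypothesis says that `m * e` divides `a * (m / gcd t m)`.
  have hd : e * Nat.gcd t m ∣ a := by
    rw [← pow_mul] at hx
    have h1 := orderOf_dvd_of_pow_eq_one hx
    rw [hgo, he] at h1
    have h2 : m = powImageCard t m * Nat.gcd t m :=
      (Nat.div_mul_cancel (Nat.gcd_dvd_right t m)).symm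
    have h3 : powImageCard t m * (e * Nat.gcd t m) ∣ powImageCard t m * a := by
      have : powImageCard t m * (e * Nat.gcd t m) = m * e := by
        conv_rhs => rw [h2]
        ring
      rw [this, mul_comm _ a]; exact h1
    exact Nat.dvd_of_mul_dvd_mul_left (powImageCard_pos t hm0) h3
  obtain ⟨b, rfl⟩ := hd
  have hge : (g ^ e) ^ m = 1 := by
    rw [← pow_mul, mul_comm, ← he, ← hgo, pow_orderOf_eq_one]
  -- Since `gcd = t * gcdA + m * gcdB` and `g ^ e` is killed by `m`, raising this to the power `t`
  -- gives `(g ^ e) ^ (gcd * b)`, which is `x`.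
  refine ⟨(g ^ e) ^ (Nat.gcdA t m * b), ?_, ?_⟩
  · have h1 : (Nat.gcd t m : ℤ) = t * Nat.gcdA t m + m * Nat.gcdB t m := Nat.gcd_eq_gcd_ab t m
    rw [mul_assoc, pow_mul, ← zpow_natCast (g ^ e) (Nat.gcd t m * b), ← zpow_natCast _ t,
      ← zpow_mul]
    push_cast
    rw [h1]
    have : (t * Nat.gcdA t m + m * Nat.gcdB t m) * (b : ℤ) =
        Nat.gcdA t m * b * t + m * (Nat.gcdB t m * b) := by ring
    rw [this, zpow_add, zpow_mul _ (m : ℤ), zpow_natCast _ m, hge, one_zpow, mul_one]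
  · rw [← zpow_natCast, ← zpow_mul, mul_comm, zpow_mul, zpow_natCast, hge, one_zpow]

/-- If there is one solution, the others form a coset of the elements killed by both `t` and `m`,
that is by their gcd; a cyclic group has exactly `gcd t m` of these. -/
theorem IsCyclic.card_pow_eq_and_pow_eq_one {C : Type*} [CommGroup C] [Fintype C] [DecidableEq C]
    [IsCyclic C] (t m : ℕ) (hm : m ∣ Nat.card C) (x : C) :
    (Finset.univ.filter fun y : C => y ^ t = x ∧ y ^ m = 1).card =
      if x ^ powImageCard t m = 1 then Nat.gcd t m else 0 := by
  split_ifs with hx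
  · obtain ⟨z, hz, hz'⟩ := IsCyclic.exists_pow_eq t m hm x hx
    have h1 : (Finset.univ.filter fun y : C => y ^ t = x ∧ y ^ m = 1).card =
        (Finset.univ.filter fun y : C => y ^ Nat.gcd t m = 1).card := by
      symm
      refine Finset.card_bij (fun y _ => z * y) ?_ (fun _ _ _ _ h => mul_left_cancel h) ?_
      · intro y hy
        simp only [Finset.mem_filter, Finset.mem_univ, true_and] at hy ⊢
        have hy' := orderOf_dvd_of_pow_eq_one hy
        rw [mul_pow, mul_pow, hz, hz',
          orderOf_dvd_iff_pow_eq_one.1 (hy'.trans (Nat.gcd_dvd_left t m)),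
          orderOf_dvd_iff_pow_eq_one.1 (hy'.trans (Nat.gcd_dvd_right t m))]
        simp
      · intro y hy
        simp only [Finset.mem_filter, Finset.mem_univ, true_and] at hy
        refine ⟨z⁻¹ * y, ?_, by simp⟩
        simp only [Finset.mem_filter, Finset.mem_univ, true_and]
        apply orderOf_dvd_iff_pow_eq_one.1
        apply Nat.dvd_gcd <;> apply orderOf_dvd_of_pow_eq_one
        · rw [mul_pow, inv_pow, hz, hy.1, inv_mul_cancel]
        · rw [mul_pow, inv_pow, hz', hy.2, inv_one, one_mul]
    rw [h1]
    have h2 := IsCyclic.card_powMonoidHom_ker C (Nat.gcd t m)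
    rw [Nat.gcd_eq_right ((Nat.gcd_dvd_right t m).trans hm)] at h2
    rw [Nat.card_eq_fintype_card, Fintype.card_subtype] at h2
    simpa only [MonoidHom.mem_ker, powMonoidHom_apply] using h2
  · rw [Finset.card_eq_zero, Finset.filter_eq_empty_iff]
    rintro y - ⟨rfl, hy⟩
    apply hx
    rw [← pow_mul]
    have : t * powImageCard t m = t / Nat.gcd t m * m := by
      unfold powImageCard
      rw [← Nat.mul_div_assoc _ (Nat.gcd_dvd_right t m),
        Nat.div_mul_right_comm (Nat.gcd_dvd_left t m)]
    rw [this, mul_comm, pow_mul, hy, one_pow]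

theorem Multiset.coe_flatMap {α β : Type*} (l : List α) (f : α → List β) :
    ((l.flatMap f : List β) : Multiset β) = (l.map fun a => (f a : Multiset β)).sum := by
  induction l with
  | nil => rfl
  | cons a l ih => simp [List.flatMap_cons, ← Multiset.coe_add, ih]

theorem Multiset.coe_flatMap_finRange {β : Type*} (k : ℕ) (f : ℕ → List β) :
    (((List.finRange k).flatMap fun i => f i.val : List β) : Multiset β) =
      ∑ i ∈ Finset.range k, (f i : Multiset β) := by
  rw [Multiset.coe_flatMap, Finset.sum_range, Fin.sum_univ_def]

/-- Elements are grouped by their value under `d`; this turns root counts by depth into tree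
multiplicities. -/
theorem Finset.map_val_eq_sum_replicate {α β : Type*} (s : Finset α) (d : α → ℕ) (k : ℕ)
    (hd : ∀ y ∈ s, d y < k) (L : ℕ → β) :
    s.val.map (fun y => L (d y)) =
      ∑ i ∈ Finset.range k, Multiset.replicate (s.filter fun y => d y = i).card (L i) := by
  classical
  have h1 : ∀ i, Multiset.replicate (s.filter fun y => d y = i).card (L i) =
      ∑ y ∈ s with d y = i, ({L (d y)} : Multiset β) := by
    intro i
    rw [Finset.sum_congr rfl (g := fun _ => ({L i} : Multiset β))
      (fun y hy => by rw [(Finset.mem_filter.1 hy).2]), Finset.sum_const, Multiset.nsmul_singleton]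
  rw [Finset.sum_congr rfl fun i _ => h1 i,
    Finset.sum_fiberwise_of_maps_to (fun y hy => Finset.mem_range.2 (hd y hy)),
    ← Multiset.sum_map_singleton (s.val.map _), Multiset.map_map]
  rfl

/-- The trees at the non-periodic roots of `x` are read off from the number of roots of each depth.
If `x` is periodic these counts produce the children of the elementary tree; if `x` has depth `k`,
those of `T^k`. -/
theorem IsKernelSeq.map_hangingTree {t n ω : ℕ} {v : List ℕ} (h : IsKernelSeq t n ω v)
    {C : Type*} [CommGroup C] [Fintype C] [DecidableEq C] [IsCyclic C] (hn : Nat.card C = n)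
    (x : C) :
    (Finset.univ.filter fun y : C => y ^ t = x ∧ ¬ orderOf y ∣ ω).val.map
        (fun y => hangingTree t n ω v (orderOf y)) =
      ((hangingTree t n ω v (orderOf x)).forest : Multiset RTree) := by
  set M : ℕ → ℕ := fun i => (powImageCard t)^[i] n with hM
  set D := v.length with hD
  set dep : C → ℕ := fun y => powDepth t n D (orderOf y) with hdep
  set s := Finset.univ.filter fun y : C => y ^ t = x ∧ ¬ orderOf y ∣ ω with hs
  have ho : ∀ y : C, orderOf y ∣ n := fun y => hn ▸ orderOf_dvd_natCard y
  have hMD : M D = ω := h.iterate_eq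
  have hMn : ∀ i, M i ∣ n := fun i => iterate_powImageCard_dvd t n (Nat.zero_le i)
  have hMsucc : ∀ i, M (i + 1) = powImageCard t (M i) :=
    fun i => Function.iterate_succ_apply' _ _ _
  have hle : ∀ (y : C) (i : ℕ), i ≤ D → (i ≤ dep y ↔ orderOf y ∣ M i) :=
    fun y i hi => le_powDepth_iff (ho y) hi
  have hlt : ∀ y : C, ¬ orderOf y ∣ ω → dep y < D := by
    intro y hy
    by_contra hh
    exact hy (hMD ▸ (hle y D le_rfl).1 (not_lt.1 hh))
  set N : ℕ → ℕ := fun i => (Finset.univ.filter fun y : C => y ^ t = x ∧ orderOf y ∣ M i).card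
    with hN
  have hNval : ∀ i, N i = if orderOf x ∣ M (i + 1) then Nat.gcd t (M i) else 0 := by
    intro i
    simp only [hN, orderOf_dvd_iff_pow_eq_one, hMsucc]
    exact IsCyclic.card_pow_eq_and_pow_eq_one t (M i) (hn ▸ hMn i) x
  -- A root has depth `i` exactly when it lies in the `i`-th image but not in the next. For `i < D`
  -- such a root is automatically non-periodic.
  have hcount : ∀ i < D, (s.filter fun y => dep y = i).card = N i - N (i + 1) := by
    intro i hi
    simp only [hN]
    rw [← Finset.card_sdiff_of_subset]
    · congr 1
      ext y
      simp only [hs, Finset.mem_filter, Finset.mem_univ, true_and, Finset.mem_sdiff, not_and]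
      rw [← hle y i hi.le, ← hle y (i + 1) hi]
      constructor
      · rintro ⟨⟨h1, h2⟩, h3⟩
        exact ⟨⟨h1, h3.ge⟩, fun _ => by omega⟩
      · rintro ⟨⟨h1, h2⟩, h3⟩
        have h4 := h3 h1
        refine ⟨⟨h1, fun h5 => h4 ?_⟩, by omega⟩
        rw [hle y (i + 1) hi]
        exact h5.trans (hMD ▸ iterate_powImageCard_dvd t n hi)
    · intro y
      simp only [Finset.mem_filter, Finset.mem_univ, true_and]
      exact fun hy => ⟨hy.1, hy.2.trans (iterate_powImageCard_dvd t n (Nat.le_succ i))⟩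
  set L := RTree.level (fun k => v.getD (k - 1) 0) with hL
  have hmap : s.val.map (fun y => hangingTree t n ω v (orderOf y)) =
      ∑ i ∈ Finset.range D, Multiset.replicate (N i - N (i + 1)) (L i) := by
    rw [Finset.sum_congr rfl (g := fun i => Multiset.replicate (s.filter fun y => dep y = i).card
      (L i)) (fun i hi => by rw [hcount i (Finset.mem_range.1 hi)]),
      ← Finset.map_val_eq_sum_replicate s dep D (fun y hy => hlt y (Finset.mem_filter.1 hy).2.2)]
    refine Multiset.map_congr rfl fun y hy => ?_
    have : ¬ orderOf y ∣ ω := (Finset.mem_filter.1 hy).2.2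
    simp only [hangingTree, if_neg this]
    rfl
  rw [hmap]
  by_cases hx : orderOf x ∣ ω
  · obtain ⟨k, hk⟩ : ∃ k, D = k + 1 := ⟨D - 1, by have := h.length_pos; omega⟩
    have hN1 : ∀ i < D, N i = v.getD i 0 := by
      intro i hi
      rw [hNval, if_pos (hx.trans (hMD ▸ iterate_powImageCard_dvd t n hi)), h.getD_eq i hi]
    -- The power map is bijective on the periodic part, so exactly one root is periodic: this is the
    -- `- 1` in the elementary tree.
    have hN2 : N D = 1 := by
      have : M (D + 1) = ω := by
        rw [hMsucc, hMD]
        unfold powImageCard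
        rw [h.coprime.gcd_eq_one, Nat.div_one]
      rw [hNval, this, if_pos hx, hMD]
      exact h.coprime
    have hforest : (hangingTree t n ω v (orderOf x)).forest =
        List.replicate (v.getD (D - 1) 0 - 1) (L (D - 1)) ++
          (List.finRange (D - 1)).flatMap fun i =>
            List.replicate (v.getD i.val 0 - v.getD (i.val + 1) 0) (L i.val) := by
      simp only [hangingTree, if_pos hx]
      rfl
    rw [hforest, ← Multiset.coe_add, hk, Nat.add_sub_cancel, Finset.sum_range_succ,
      Multiset.coe_flatMap_finRange k fun i =>
        List.replicate (v.getD i 0 - v.getD (i + 1) 0) (L i), Multiset.coe_replicate, add_comm]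
    rw [← hk, hN2, hN1 k (by omega)]
    congr 1
    refine Finset.sum_congr rfl fun i hi => ?_
    have := Finset.mem_range.1 hi
    rw [hN1 i (by omega), hN1 (i + 1) (by omega), Multiset.coe_replicate]
  · have hkD : dep x < D := hlt x hx
    have hN1 : ∀ i < dep x, N i = v.getD i 0 := by
      intro i hi
      rw [hNval, if_pos ((hle x (i + 1) (by omega)).1 hi), h.getD_eq i (by omega)]
    -- A root of depth at least `dep x` would put `x` one image deeper than it is. So the last
    -- nonzero difference is a full count, without subtraction.
    have hN2 : ∀ i, dep x ≤ i → N i = 0 := by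
      intro i hi
      rw [hNval, if_neg]
      intro h1
      have h2 : orderOf x ∣ M (dep x + 1) :=
        h1.trans (iterate_powImageCard_dvd t n (by omega))
      have := (hle x (dep x + 1) hkD).2 h2
      omega
    have hsum : ∑ i ∈ Finset.range D, Multiset.replicate (N i - N (i + 1)) (L i) =
        ∑ i ∈ Finset.range (dep x), Multiset.replicate (N i - N (i + 1)) (L i) := by
      symm
      refine Finset.sum_subset (Finset.range_subset_range.2 hkD.le) fun i _ hi => ?_
      rw [hN2 i (by simpa using hi)]
      simp
    have hforest : hangingTree t n ω v (orderOf x) = L (dep x) := by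
      simp only [hangingTree, if_neg hx]
      rfl
    rw [hsum, hforest]
    rcases hk : dep x with _ | k
    · simp only [hL]
      rw [RTree.level]
      rfl
    · have hlev : (L (k + 1)).forest = List.replicate (v.getD k 0) (L k) ++
          (List.finRange k).flatMap fun i =>
            List.replicate (v.getD i.val 0 - v.getD (i.val + 1) 0) (L i.val) := by
        simp only [hL]
        conv_lhs => rw [RTree.level]
        rfl
      rw [hlev, ← Multiset.coe_add, Finset.sum_range_succ,
        Multiset.coe_flatMap_finRange k fun i =>
          List.replicate (v.getD i 0 - v.getD (i + 1) 0) (L i), Multiset.coe_replicate, add_comm]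
      rw [hN1 k (by omega), hN2 (k + 1) (by omega), Nat.sub_zero]
      congr 1
      refine Finset.sum_congr rfl fun i hi => ?_
      have := Finset.mem_range.1 hi
      rw [hN1 i (by omega), hN1 (i + 1) (by omega), Multiset.coe_replicate]

/-- Equality of multisets is a permutation of lists, and it lifts along `c` to a reordering of `s`
itself. -/
theorem exists_enumeration {V β : Type*} (s : Finset V) (c : V → β) (l : List β)
    (h : s.val.map c = (l : Multiset β)) :
    ∃ k : Fin l.length → V, Function.Injective k ∧ (∀ y, (∃ j, k j = y) ↔ y ∈ s) ∧
      ∀ j, c (k j) = l.get j := by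
  rw [← Finset.coe_toList s, Multiset.map_coe, Multiset.coe_eq_coe] at h
  have h' : Relation.Comp (fun a b => a = List.map c b) (fun a b => List.Perm a b) l s.toList := by
    rw [List.eq_map_comp_perm]; exact h.symm
  obtain ⟨L, rfl, hL⟩ := h'
  have hnd : L.Nodup := hL.nodup_iff.2 s.nodup_toList
  refine ⟨fun j => L.get (j.cast (by simp)), ?_, ?_, ?_⟩
  · intro i j hij
    have := List.nodup_iff_injective_get.1 hnd hij
    exact Fin.ext (by simpa using Fin.ext_iff.1 this)
  · intro y
    rw [← Finset.mem_toList, ← hL.mem_iff, List.mem_iff_get]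
    constructor
    · rintro ⟨j, hj⟩
      exact ⟨_, hj⟩
    · rintro ⟨j, hj⟩
      exact ⟨j.cast (by simp), hj⟩
  · intro j
    simp

theorem IsKernelSeq.map_hangingTree_subgroup {t n ω : ℕ} {v : List ℕ} (h : IsKernelSeq t n ω v)
    {G : Type*} [Group G] [Fintype G] [DecidableEq G] (H : Subgroup G) [DecidablePred (· ∈ H)]
    [IsCyclic H] (hn : Nat.card H = n) (x : G) (hx : x ∈ H) :
    (Finset.univ.filter fun y : G => y ∈ H ∧ y ^ t = x ∧ ¬ orderOf y ∣ ω).val.map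
        (fun y => hangingTree t n ω v (orderOf y)) =
      ((hangingTree t n ω v (orderOf x)).forest : Multiset RTree) := by
  let _ : CommGroup H := IsCyclic.commGroup
  have key := h.map_hangingTree (C := H) hn ⟨x, hx⟩
  rw [Subgroup.orderOf_mk] at key
  rw [← key]
  have : (Finset.univ.filter fun y : G => y ∈ H ∧ y ^ t = x ∧ ¬ orderOf y ∣ ω) =
      (Finset.univ.filter fun y : H => y ^ t = ⟨x, hx⟩ ∧ ¬ orderOf y ∣ ω).map
        (Function.Embedding.subtype _) := by
    ext y
    simp only [Finset.mem_filter, Finset.mem_univ, true_and, Finset.mem_map,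
      Function.Embedding.subtype_apply]
    constructor
    · rintro ⟨h1, h2, h3⟩
      exact ⟨⟨y, h1⟩, ⟨Subtype.ext h2, by rwa [Subgroup.orderOf_mk]⟩, rfl⟩
    · rintro ⟨y, ⟨h2, h3⟩, rfl⟩
      exact ⟨y.2, congrArg Subtype.val h2, by rwa [Subgroup.orderOf_coe]⟩
  rw [this, Finset.map_val, Multiset.map_map]
  simp only [Function.comp_def, Function.Embedding.subtype_apply, Subgroup.orderOf_coe]

theorem orderOf_pow_dvd_powImageCard {G : Type*} [Group G] (t m : ℕ) (y : G)
    (hy : orderOf y ∣ m) : orderOf (y ^ t) ∣ powImageCard t m := by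
  rw [orderOf_dvd_iff_pow_eq_one] at hy ⊢
  rw [← pow_mul]
  have : t * powImageCard t m = m * (t / Nat.gcd t m) := by
    unfold powImageCard
    rw [← Nat.mul_div_assoc _ (Nat.gcd_dvd_right t m), mul_comm m,
      Nat.div_mul_right_comm (Nat.gcd_dvd_left t m)]
  rw [this, pow_mul, hy, one_pow]

theorem iterate_pow_eq {G : Type*} [Monoid G] (t j : ℕ) (x : G) :
    (fun g : G => g ^ t)^[j] x = x ^ t ^ j := by
  induction j with
  | zero => simp
  | succ j ih => rw [Function.iterate_succ_apply', ih, ← pow_mul, pow_succ]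

theorem orderOf_iterate_pow_dvd {G : Type*} [Group G] (t n : ℕ) (y : G)
    (hy : orderOf y ∣ n) (j : ℕ) : orderOf ((fun g : G => g ^ t)^[j] y) ∣ (powImageCard t)^[j] n := by
  induction j with
  | zero => exact hy
  | succ j ih =>
    rw [Function.iterate_succ_apply', Function.iterate_succ_apply']
    exact orderOf_pow_dvd_powImageCard t _ _ ih

theorem ord_pos {d t : ℕ} (hd : 0 < d) (h : Nat.Coprime t d) : 0 < ord d t := by
  have : NeZero d := ⟨hd.ne'⟩
  rw [ord, ← ZMod.coe_unitOfCoprime t h, orderOf_units]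
  exact orderOf_pos _

/-- Both sides say that `t ^ j` is congruent to `1` modulo the order of `x`; thus cycle lengths
depend only on orders. -/
theorem pow_pow_eq_self_iff {G : Type*} [Group G] {t d : ℕ} {x : G}
    (hx : orderOf x = d) (j : ℕ) : x ^ t ^ j = x ↔ ord d t ∣ j := by
  rw [ord, orderOf_dvd_iff_pow_eq_one, ← Nat.cast_pow, ← Nat.cast_one, ZMod.natCast_eq_natCast_iff,
    ← hx, ← pow_eq_pow_iff_modEq, pow_one]

/-- The elements of order `d` in the subgroups `H i` form cycles of the power map. -/
theorem exists_equiv_orderOf_eq {G ι : Type*} [Group G] [Finite G] [Finite ι] (H : ι → Subgroup G)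
    [∀ i, IsCyclic (H i)] (m n t d : ℕ) (hm : Nat.card ι = m)
    (hn : ∀ i, Nat.card (H i) = n) (hd : d ∣ n)
    (hd1 : d ≠ 1) (hd0 : 0 < d) (hdt : Nat.Coprime t d)
    (hH : ∀ g : G, g ≠ 1 → ∀ i j, g ∈ H i → g ∈ H j → i = j) :
    ∃ e : (Σ _ : Fin (m * Nat.totient d / ord d t), ZMod (ord d t)) ≃
        {g : G // (∃ i, g ∈ H i) ∧ orderOf g = d},
      ∀ j z, (e ⟨j, z + 1⟩).1 = (e ⟨j, z⟩).1 ^ t := by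
  classical
  have := Fintype.ofFinite G
  have := Fintype.ofFinite ι
  have hord : ∀ g : G, orderOf g = d → orderOf (g ^ t) = d := by
    intro g hg
    rw [Nat.Coprime.orderOf_pow (by rw [hg]; exact hdt.symm), hg]
  let f : {g : G // (∃ i, g ∈ H i) ∧ orderOf g = d} → {g : G // (∃ i, g ∈ H i) ∧ orderOf g = d} :=
    fun g => ⟨g.1 ^ t, ⟨g.2.1.choose, pow_mem g.2.1.choose_spec t⟩, hord g.1 g.2.2⟩
  have hf : ∀ (j : ℕ) g, (f^[j] g).1 = g.1 ^ t ^ j := by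
    intro j g
    rw [← iterate_pow_eq]
    exact (Function.Semiconj.iterate_right (f := Subtype.val) (ga := f)
      (gb := fun g : G => g ^ t) (fun _ => rfl) j) g
  have hper : ∀ g, Function.minimalPeriod f g = ord d t := by
    intro g
    have hiff : ∀ j, Function.minimalPeriod f g ∣ j ↔ ord d t ∣ j := by
      intro j
      rw [← Function.isPeriodicPt_iff_minimalPeriod_dvd, ← pow_pow_eq_self_iff g.2.2, ← hf j g,
        ← Subtype.ext_iff]
      rfl
    exact Nat.dvd_antisymm ((hiff _).2 dvd_rfl) ((hiff _).1 dvd_rfl)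
  have hcard : Nat.card {g : G // (∃ i, g ∈ H i) ∧ orderOf g = d} =
      m * Nat.totient d := by
    let E : (Σ i, {g : H i // orderOf g = d}) → {g : G // (∃ i, g ∈ H i) ∧ orderOf g = d} :=
      fun a => ⟨a.2.1.1, ⟨a.1, a.2.1.2⟩, by rw [Subgroup.orderOf_coe]; exact a.2.2⟩
    have hE : Function.Bijective E := by
      constructor
      · rintro ⟨i, ⟨g, hg⟩, hgd⟩ ⟨j, ⟨g', hg'⟩, hgd'⟩ hab
        have hgg : g = g' := congrArg Subtype.val hab
        subst hgg
        have hg1 : g ≠ 1 := by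
          rintro rfl
          rw [Subgroup.orderOf_mk, orderOf_one] at hgd
          exact hd1 hgd.symm
        obtain rfl := hH g hg1 i j hg hg'
        rfl
      · rintro ⟨g, ⟨i, hi⟩, hg⟩
        exact ⟨⟨i, ⟨g, hi⟩, by rwa [Subgroup.orderOf_mk]⟩, rfl⟩
    rw [← Nat.card_congr (Equiv.ofBijective E hE), Nat.card_sigma]
    have : ∀ i, Nat.card {g : H i // orderOf g = d} = Nat.totient d := by
      intro i
      rw [Nat.card_eq_fintype_card, Fintype.card_subtype]
      exact IsCyclic.card_orderOf_eq_totient (by rw [← Nat.card_eq_fintype_card, hn]; exact hd)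
    rw [Finset.sum_congr rfl fun i _ => this i, Finset.sum_const, Finset.card_univ, smul_eq_mul,
      ← Nat.card_eq_fintype_card, hm]
  obtain ⟨e, he⟩ := exists_equiv_cycles f (ord d t) (ord_pos hd0 hdt) hper
    (m * Nat.totient d / ord d t) (by rw [hcard])
  exact ⟨e, fun j z => congrArg Subtype.val (he j z)⟩

/-- The power map on a finite group which is the union of cyclic subgroups meeting pairwise
trivially. -/
theorem isomorphic_of_partition {G ι κ : Type*} [Group G] [Finite G] [Finite ι] [Fintype κ]
    (H : ι → Subgroup G) (hcyc : ∀ i, IsCyclic (H i)) (τ : ι → κ) (m n ω : κ → ℕ)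
    (v : κ → List ℕ) (t : ℕ) (hn : ∀ i, Nat.card (H i) = n (τ i))
    (hm : ∀ k, Nat.card {i // τ i = k} = m k) (hcover : ∀ g : G, g ≠ 1 → ∃ i, g ∈ H i)
    (hdisj : ∀ g : G, g ≠ 1 → ∀ i j, g ∈ H i → g ∈ H j → i = j)
    (hv : ∀ k, IsKernelSeq t (n k) (ω k) (v k)) (S : RTree)
    (hS : (S.forest : Multiset RTree) =
      ∑ k, m k • ((RTree.elementary (v k)).forest : Multiset RTree)) :
    Isomorphic (functionalGraph fun g : G => g ^ t)
      (disjSum (disjUnion fun k => cycleFamily (m k) (ω k) t (RTree.elementary (v k)))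
        (Cyc 1 S)) := by
  classical
  have := Fintype.ofFinite G
  have := Fintype.ofFinite ι
  have hωpos : ∀ k, 0 < ω k := fun k => Nat.pos_of_dvd_of_pos (hv k).dvd (hv k).pos
  have hcop : ∀ k d, d ∣ ω k → Nat.Coprime t d := fun k d hd => (hv k).coprime.coprime_dvd_right hd
  have hex : ∀ (k : κ) (d : {d : ℕ // d ∣ ω k ∧ d ≠ 1}), _ := fun k d =>
    exists_equiv_orderOf_eq (fun i : {i // τ i = k} => H i) (m k) (n k) t d (hm k)
      (fun i => by rw [hn, i.2]) (d.2.1.trans (hv k).dvd) d.2.2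
      (Nat.pos_of_dvd_of_pos d.2.1 (hωpos k)) (hcop k d d.2.1)
      (fun g hg i j hi hj => Subtype.ext (hdisj g hg i j hi hj))
  choose e he using hex
  -- The periodic elements are indexed by the cycle vertices of the target graph, with the identity
  -- as the extra one-vertex cycle, so that the two decorations share their index type and rotation.
  let a : (Σ k, Σ d : {d : ℕ // d ∣ ω k ∧ d ≠ 1},
      Σ _ : Fin (m k * Nat.totient d / ord d t), ZMod (ord d t)) ⊕ ZMod 1 → G :=
    Sum.elim (fun z => (e z.1 z.2.1 z.2.2).1) fun _ => 1
  have hne : ∀ k d z, (e k d z).1 ≠ 1 := by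
    intro k d z h1
    have := (e k d z).2.2
    rw [h1, orderOf_one] at this
    exact d.2.2 this.symm
  have hrange : ∀ g i, g ∈ H i → (g ∈ Set.range a ↔ orderOf g ∣ ω (τ i)) := by
    intro g i hg
    constructor
    · rintro ⟨(⟨k, d, z⟩ | z), rfl⟩
      · obtain ⟨⟨⟨j, rfl⟩, hj⟩, ho⟩ := (e k d z).2
        have hij : i = j := hdisj _ (hne _ d z) i j hg hj
        subst hij
        change orderOf (e (τ i) d z).1 ∣ _
        rw [ho]
        exact d.2.1
      · simp [a]
    · intro ho
      by_cases hg1 : g = 1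
      · exact ⟨Sum.inr 0, hg1.symm⟩
      · refine ⟨Sum.inl ⟨τ i, ⟨orderOf g, ho, by rwa [ne_eq, orderOf_eq_one_iff]⟩,
          (e (τ i) _).symm ⟨g, ⟨⟨i, rfl⟩, hg⟩, rfl⟩⟩, ?_⟩
        simp [a]
  -- The identity lies in every `H i`, so it needs the sum of the trees; any other element lies in a
  -- single `H i`.
  let c : G → RTree := fun g =>
    if h : g = 1 then S
    else hangingTree t (n (τ (hcover g h).choose)) (ω (τ (hcover g h).choose))
      (v (τ (hcover g h).choose)) (orderOf g)
  have hc : ∀ g i, g ≠ 1 → g ∈ H i →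
      c g = hangingTree t (n (τ i)) (ω (τ i)) (v (τ i)) (orderOf g) := by
    intro g i hg hi
    have : (hcover g hg).choose = i := hdisj g hg _ _ (hcover g hg).choose_spec hi
    simp only [c, dif_neg hg, this]
  have hdec : IsDecorated (functionalGraph fun g : G => g ^ t) (fun g => g ^ t) a
      (Sum.map (Sigma.map id fun k => Sigma.map id fun d => Sigma.map id fun _ z =>
        (z + 1 : ZMod (ord d t))) fun z => z + 1) c := by
    refine ⟨fun _ _ => Iff.rfl, ?_, ?_, ?_, ?_⟩
    · rintro (⟨k, d, z⟩ | z) (⟨k', d', z'⟩ | z') h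
      · change (e k d z).1 = (e k' d' z').1 at h
        obtain ⟨⟨⟨i, rfl⟩, hi⟩, ho⟩ := (e k d z).2
        obtain ⟨⟨⟨j, rfl⟩, hj⟩, ho'⟩ := (e k' d' z').2
        have hij : i = j := hdisj _ (hne _ d z) i j hi (by rw [h]; exact hj)
        subst hij
        have hd : d = d' := Subtype.ext (by rw [← ho, ← ho', h])
        subst hd
        rw [(e _ d).injective (Subtype.ext h)]
      · exact absurd h (hne k d z)
      · exact absurd h.symm (hne k' d' z')
      · rw [Subsingleton.elim z z']
    · rintro (⟨k, d, j, z⟩ | z)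
      · exact (he k d j z).symm
      · exact one_pow t
    · intro x
      by_cases hx : x = 1
      · exact ⟨0, Sum.inr 0, hx.symm⟩
      · obtain ⟨i, hi⟩ := hcover x hx
        refine ⟨(v (τ i)).length, ?_⟩
        rw [hrange _ i]
        · rw [← (hv (τ i)).iterate_eq]
          exact orderOf_iterate_pow_dvd t _ x (by
            rw [← hn i, ← Subgroup.orderOf_mk x hi]; exact orderOf_dvd_natCard _) _
        · rw [iterate_pow_eq]
          exact pow_mem hi _
    · intro x
      have hmem : ∀ y, y ∈ (Finset.univ.filter fun y : G => y ^ t = x ∧ y ∉ Set.range a) ↔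
          y ^ t = x ∧ y ∉ Set.range a := by simp
      have key : (Finset.univ.filter fun y : G => y ^ t = x ∧ y ∉ Set.range a).val.map c =
          ((c x).forest : Multiset RTree) := by
        by_cases hx : x = 1
        · subst hx
          -- A non-periodic root of `1` is nontrivial, hence in a single `H i`; the preimages of `1`
          -- split as a disjoint union over all subgroups.
          have hpd : ((Finset.univ : Finset ι) : Set ι).PairwiseDisjoint fun i =>
              Finset.univ.filter fun y : G => y ∈ H i ∧ y ^ t = 1 ∧ ¬ orderOf y ∣ ω (τ i) := by
            intro i _ j _ hij
            rw [Function.onFun, Finset.disjoint_left]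
            intro y hy hy'
            simp only [Finset.mem_filter, Finset.mem_univ, true_and] at hy hy'
            refine hij (hdisj y ?_ i j hy.1 hy'.1)
            rintro rfl
            exact hy.2.2 (by simp)
          have h1 : (Finset.univ.filter fun y : G => y ^ t = 1 ∧ y ∉ Set.range a) =
              Finset.univ.disjiUnion _ hpd := by
            ext y
            simp only [Finset.mem_filter, Finset.mem_univ, true_and, Finset.mem_disjiUnion]
            constructor
            · rintro ⟨h1, h2⟩
              have hy : y ≠ 1 := by
                rintro rfl
                exact h2 ⟨Sum.inr 0, rfl⟩
              obtain ⟨i, hi⟩ := hcover y hy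
              exact ⟨i, hi, h1, by rwa [hrange y i hi] at h2⟩
            · rintro ⟨i, hi, h1, h2⟩
              exact ⟨h1, by rwa [hrange y i hi]⟩
          have h2 : ∀ i, (Finset.univ.filter fun y : G =>
              y ∈ H i ∧ y ^ t = 1 ∧ ¬ orderOf y ∣ ω (τ i)).val.map c =
                ((RTree.elementary (v (τ i))).forest : Multiset RTree) := by
            intro i
            have h3 := (hv (τ i)).map_hangingTree_subgroup (H i) (hn i) 1 (one_mem _)
            rw [orderOf_one, hangingTree, if_pos (one_dvd _)] at h3
            rw [← h3]
            refine Multiset.map_congr rfl fun y hy => ?_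
            have hy' := (Finset.mem_filter.1 hy).2
            refine hc y i ?_ hy'.1
            rintro rfl
            exact hy'.2.2 (by simp)
          have hc1 : c 1 = S := dif_pos rfl
          rw [h1, hc1, hS, Finset.disjiUnion_val, Multiset.map_bind]
          simp only [h2]
          change ∑ i, ((RTree.elementary (v (τ i))).forest : Multiset RTree) = _
          rw [← Finset.sum_fiberwise Finset.univ τ]
          refine Finset.sum_congr rfl fun k _ => ?_
          rw [Finset.sum_congr rfl (g := fun _ => ((RTree.elementary (v k)).forest :
            Multiset RTree)) (fun i hi => by rw [(Finset.mem_filter.1 hi).2]), Finset.sum_const,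
            ← hm k, Nat.card_eq_fintype_card, Fintype.card_subtype]
        · obtain ⟨i, hi⟩ := hcover x hx
          have h1 : (Finset.univ.filter fun y : G => y ^ t = x ∧ y ∉ Set.range a) =
              Finset.univ.filter fun y : G =>
                y ∈ H i ∧ y ^ t = x ∧ ¬ orderOf y ∣ ω (τ i) := by
            ext y
            simp only [Finset.mem_filter, Finset.mem_univ, true_and]
            constructor
            · rintro ⟨h1, h2⟩
              have hy : y ≠ 1 := by
                rintro rfl
                exact h2 ⟨Sum.inr 0, rfl⟩
              obtain ⟨j, hj⟩ := hcover y hy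
              -- If `y` is in `H j`, so is its power `x`; as `x ≠ 1`, all roots of `x` stay in the
              -- subgroup of `x`.
              obtain rfl := hdisj x hx i j hi (h1 ▸ pow_mem hj t)
              exact ⟨hj, h1, by rwa [hrange y i hj] at h2⟩
            · rintro ⟨hj, h1, h2⟩
              exact ⟨h1, by rwa [hrange y i hj]⟩
          rw [h1, hc x i hx hi, ← (hv (τ i)).map_hangingTree_subgroup (H i) (hn i) x hi]
          refine Multiset.map_congr rfl fun y hy => ?_
          have hy' := (Finset.mem_filter.1 hy).2
          refine hc y i ?_ hy'.1
          rintro rfl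
          exact hy'.2.2 (by simp)
      obtain ⟨k, hk1, hk2, hk3⟩ := exists_enumeration _ c _ key
      exact ⟨k, hk1, fun y => (hk2 y).trans (hmem y), hk3⟩
  refine hdec.isomorphic (IsDecorated.disjSum (IsDecorated.disjUnion fun k =>
    IsDecorated.disjUnion fun d : {d : ℕ // d ∣ ω k ∧ d ≠ 1} => IsDecorated.disjUnion
      fun _ : Fin (m k * Nat.totient d / ord d t) => isDecorated_cyc (ord d t) _)
    (isDecorated_cyc 1 S)) ?_
  rintro (⟨k, d, z⟩ | z)
  · change c (e k d z).1 = RTree.subtree (RTree.root (RTree.elementary (v k)))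
    obtain ⟨⟨⟨i, rfl⟩, hi⟩, ho⟩ := (e k d z).2
    rw [RTree.subtree_root, hc _ i (hne _ d z) hi, hangingTree, if_pos (by rw [ho]; exact d.2.1)]
  · change c 1 = RTree.subtree (RTree.root _)
    rw [RTree.subtree_root]
    exact dif_pos rfl

open Matrix

/-! ### Centralizers in `GL(2, F)` and their images in `PGL(2, F)`. -/

section Tori

variable {F : Type*} [Field F]

theorem mk_eq_mk_iff_smul {g h : GL (Fin 2) F} :
    ProjGenLinGroup.mk g = ProjGenLinGroup.mk h ↔
      ∃ u : F, (h : Matrix (Fin 2) (Fin 2) F) = u • (g : Matrix (Fin 2) (Fin 2) F) := by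
  rw [ProjGenLinGroup.mk_eq_mk_iff]
  have key : ∀ u : Fˣ, ((g * GeneralLinearGroup.scalar (Fin 2) u : GL (Fin 2) F) :
      Matrix (Fin 2) (Fin 2) F) = u.1 • (g : Matrix (Fin 2) (Fin 2) F) := by
    intro u
    rw [Units.val_mul, GeneralLinearGroup.coe_scalar, Matrix.scalar_apply,
      ← Matrix.smul_one_eq_diagonal, Matrix.mul_smul, Matrix.mul_one]
  constructor
  · rintro ⟨u, rfl⟩
    exact ⟨u, key u⟩
  · rintro ⟨u, hu⟩
    have hu0 : u ≠ 0 := by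
      rintro rfl
      rw [zero_smul] at hu
      exact h.ne_zero hu
    refine ⟨Units.mk0 u hu0, Units.ext ?_⟩
    rw [key, hu, Units.val_mk0]

theorem mk_eq_one_iff_smul {g : GL (Fin 2) F} :
    ProjGenLinGroup.mk g = 1 ↔
      ∃ u : F, (g : Matrix (Fin 2) (Fin 2) F) = u • (1 : Matrix (Fin 2) (Fin 2) F) := by
  rw [eq_comm, ← map_one (ProjGenLinGroup.mk (n := Fin 2) (R := F)), mk_eq_mk_iff_smul]
  rfl

theorem eq_zero_of_smul_one_add_smul_eq_zero {B : Matrix (Fin 2) (Fin 2) F}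
    (hB : ¬ ∃ u : F, B = u • 1) {a b : F} (h : a • (1 : Matrix (Fin 2) (Fin 2) F) + b • B = 0) :
    a = 0 ∧ b = 0 := by
  have hb : b = 0 := by
    by_contra hb
    refine hB ⟨-(b⁻¹ * a), ?_⟩
    have h1 : b • B = -(a • (1 : Matrix (Fin 2) (Fin 2) F)) := by
      rw [add_comm] at h
      exact eq_neg_of_add_eq_zero_left h
    rw [neg_smul, mul_smul, ← smul_neg, ← h1, smul_smul, inv_mul_cancel₀ hb, one_smul]
  subst hb
  simpa using h

/-- The coefficient `b` is a ratio of corresponding entries of `C` and `B`, taken at a nonzero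
off-diagonal entry of `B` or, if `B` is diagonal, at the difference of its distinct diagonal
entries. -/
theorem exists_smul_one_add_smul_of_commute {B C : Matrix (Fin 2) (Fin 2) F}
    (hB : ¬ ∃ u : F, B = u • 1) (h : C * B = B * C) :
    ∃ a b : F, C = a • (1 : Matrix (Fin 2) (Fin 2) F) + b • B := by
  have h00 := congrFun (congrFun h 0) 0
  have h01 := congrFun (congrFun h 0) 1
  have h10 := congrFun (congrFun h 1) 0
  simp only [Matrix.mul_apply, Fin.sum_univ_two] at h00 h01 h10
  by_cases hy : B 0 1 = 0
  · by_cases hz : B 1 0 = 0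
    · have hxw : B 0 0 - B 1 1 ≠ 0 := by
        intro hxw
        refine hB ⟨B 0 0, ?_⟩
        ext i j
        fin_cases i <;> fin_cases j <;> simp [hy, hz, ← sub_eq_zero.1 hxw]
      have hc01 : C 0 1 = 0 := by
        rw [hy] at h01
        have : (B 0 0 - B 1 1) * C 0 1 = 0 := by linear_combination -h01
        exact (mul_eq_zero.1 this).resolve_left hxw
      have hc10 : C 1 0 = 0 := by
        rw [hz] at h10
        have : (B 0 0 - B 1 1) * C 1 0 = 0 := by linear_combination h10
        exact (mul_eq_zero.1 this).resolve_left hxw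
      refine ⟨C 0 0 - (C 0 0 - C 1 1) / (B 0 0 - B 1 1) * B 0 0,
        (C 0 0 - C 1 1) / (B 0 0 - B 1 1), ?_⟩
      ext i j
      fin_cases i <;> fin_cases j <;> simp [hy, hz, hc01, hc10]
      field_simp
      ring
    · refine ⟨C 0 0 - C 1 0 / B 1 0 * B 0 0, C 1 0 / B 1 0, ?_⟩
      ext i j
      fin_cases i <;> fin_cases j <;> simp [hz]
      · field_simp
        linear_combination h00
      · field_simp
        linear_combination h10
  · refine ⟨C 0 0 - C 0 1 / B 0 1 * B 0 0, C 0 1 / B 0 1, ?_⟩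
    ext i j
    fin_cases i <;> fin_cases j <;> simp [hy]
    · field_simp
      linear_combination -h00
    · field_simp
      linear_combination -h01

/-- The image in `PGL(2, F)` of the centralizer of `g`. -/
def torus (g : GL (Fin 2) F) : Subgroup PGL(2, F) :=
  (Subgroup.centralizer {g}).map ProjGenLinGroup.mk

theorem mk_mem_torus {g h : GL (Fin 2) F} :
    ProjGenLinGroup.mk h ∈ torus g ↔ (h : Matrix (Fin 2) (Fin 2) F) * (g : Matrix _ _ F) =
      (g : Matrix (Fin 2) (Fin 2) F) * (h : Matrix (Fin 2) (Fin 2) F) := by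
  simp only [torus, Subgroup.mem_map, Subgroup.mem_centralizer_singleton_iff]
  constructor
  · rintro ⟨k, hk, hkh⟩
    obtain ⟨u, hu⟩ := mk_eq_mk_iff_smul.1 hkh
    rw [hu, Matrix.smul_mul, Matrix.mul_smul]
    congr 1
    exact congrArg Units.val hk
  · intro hh
    exact ⟨h, Units.ext hh, rfl⟩

/-- For nonscalar commuting `g` and `h`, each is a combination of `1` and the other, so the same
matrices commute with both. -/
theorem torus_eq_of_mem {g h : GL (Fin 2) F} (hg : ProjGenLinGroup.mk g ≠ 1)
    (hh : ProjGenLinGroup.mk h ≠ 1) (h1 : ProjGenLinGroup.mk h ∈ torus g) :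
    torus h = torus g := by
  rw [mk_mem_torus] at h1
  rw [Ne, mk_eq_one_iff_smul] at hg hh
  ext x
  induction x using ProjGenLinGroup.induction_on with
  | mk k =>
    rw [mk_mem_torus, mk_mem_torus]
    constructor
    · intro hk
      obtain ⟨a, b, hab⟩ := exists_smul_one_add_smul_of_commute hh h1.symm
      rw [hab, Matrix.mul_add, Matrix.add_mul, Matrix.mul_smul, Matrix.smul_mul, Matrix.mul_smul,
        Matrix.smul_mul, hk, Matrix.mul_one, Matrix.one_mul]
    · intro hk
      obtain ⟨a, b, hab⟩ := exists_smul_one_add_smul_of_commute hg h1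
      rw [hab, Matrix.mul_add, Matrix.add_mul, Matrix.mul_smul, Matrix.smul_mul, Matrix.mul_smul,
        Matrix.smul_mul, hk, Matrix.mul_one, Matrix.one_mul]

/-! ### Split tori -/

/-- The matrices with eigenvalues `1` and `c` on the image and the kernel of the idempotent `E`. -/
def splitHom (E : Matrix (Fin 2) (Fin 2) F) (hE : E * E = E) : F →* Matrix (Fin 2) (Fin 2) F where
  toFun c := E + c • (1 - E)
  map_one' := by simp
  map_mul' c d := by
    simp only [mul_add, add_mul, mul_sub, sub_mul, Matrix.smul_mul, Matrix.mul_smul, hE, mul_one,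
      one_mul]
    module

/-- The one-parameter subgroup of `PGL(2, F)` attached to an idempotent. -/
def splitTorus (E : Matrix (Fin 2) (Fin 2) F) (hE : E * E = E) : Fˣ →* PGL(2, F) :=
  ProjGenLinGroup.mk.comp (Units.map (splitHom E hE))

theorem splitTorus_eq_iff {E E' : Matrix (Fin 2) (Fin 2) F} {hE : E * E = E} {hE' : E' * E' = E'}
    {c c' : Fˣ} : splitTorus E hE c = splitTorus E' hE' c' ↔
      ∃ u : F, E' + c'.1 • (1 - E') = u • (E + c.1 • (1 - E)) :=
  mk_eq_mk_iff_smul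

theorem not_scalar_idempotent {E : Matrix (Fin 2) (Fin 2) F} (hE : E * E = E) (h0 : E ≠ 0)
    (h1 : E ≠ 1) : ¬ ∃ u : F, E = u • 1 := by
  rintro ⟨u, rfl⟩
  have h := congrFun (congrFun hE 0) 0
  simp only [Matrix.smul_mul, one_mul, Matrix.smul_apply, Matrix.one_apply_eq, smul_eq_mul,
    mul_one] at h
  by_cases hu : u = 0
  · exact h0 (by rw [hu, zero_smul])
  · exact h1 (by rw [(mul_eq_left₀ hu).1 h, one_smul])

theorem not_scalar_split {E : Matrix (Fin 2) (Fin 2) F} (hE : E * E = E) (h0 : E ≠ 0)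
    (h1 : E ≠ 1) {c : F} (hc : c ≠ 1) : ¬ ∃ u : F, E + c • (1 - E) = u • 1 := by
  rintro ⟨u, hu⟩
  have h : (c - u) • (1 : Matrix (Fin 2) (Fin 2) F) + (1 - c) • E = 0 := by
    rw [← sub_eq_zero] at hu
    rw [← hu]
    module
  exact hc (sub_eq_zero.1
    (eq_zero_of_smul_one_add_smul_eq_zero (not_scalar_idempotent hE h0 h1) h).2).symm

theorem splitTorus_ne_one {E : Matrix (Fin 2) (Fin 2) F} (hE : E * E = E) (h0 : E ≠ 0)
    (h1 : E ≠ 1) {c : Fˣ} (hc : c ≠ 1) : splitTorus E hE c ≠ 1 := by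
  intro h
  exact not_scalar_split hE h0 h1 (c := c.1) (by simpa using hc) (mk_eq_one_iff_smul.1 h)

theorem splitTorus_injective {E : Matrix (Fin 2) (Fin 2) F} (hE : E * E = E) (h0 : E ≠ 0)
    (h1 : E ≠ 1) : Function.Injective (splitTorus E hE) := by
  rw [injective_iff_map_eq_one]
  intro c hc
  by_contra hc1
  exact splitTorus_ne_one hE h0 h1 hc1 hc

/-- A matrix commuting with `E + c(1 - E)` has the form `uE + v(1 - E)`. Invertibility makes `u` and
`v` nonzero, and its class depends only on `v / u`. -/
theorem torus_splitTorus {E : Matrix (Fin 2) (Fin 2) F} (hE : E * E = E) (h0 : E ≠ 0)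
    (h1 : E ≠ 1) {c : Fˣ} (hc : c ≠ 1) :
    torus (Units.map (splitHom E hE) c) = (splitTorus E hE).range := by
  ext x
  induction x using ProjGenLinGroup.induction_on with
  | mk k =>
    constructor
    · intro hk
      rw [mk_mem_torus] at hk
      obtain ⟨a, b, hab⟩ := exists_smul_one_add_smul_of_commute
        (not_scalar_split hE h0 h1 (c := c.1) (by simpa using hc)) hk
      have hk' : (k : Matrix (Fin 2) (Fin 2) F) = (a + b) • E + (a + b * c.1) • (1 - E) := by
        rw [hab]
        module
      have hu : a + b ≠ 0 := by
        intro hu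
        rw [hu, zero_smul, zero_add] at hk'
        have : (k : Matrix (Fin 2) (Fin 2) F) * E = 0 := by
          rw [hk', Matrix.smul_mul, sub_mul, hE, one_mul, sub_self, smul_zero]
        exact h0 ((Units.mul_right_eq_zero k).1 this)
      have hv : a + b * c.1 ≠ 0 := by
        intro hv
        rw [hv, zero_smul, add_zero] at hk'
        have : (k : Matrix (Fin 2) (Fin 2) F) * (1 - E) = 0 := by
          rw [hk', Matrix.smul_mul, mul_sub, hE, mul_one, sub_self, smul_zero]
        exact h1 (sub_eq_zero.1 ((Units.mul_right_eq_zero k).1 this)).symm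
      refine ⟨Units.mk0 ((a + b * c.1) / (a + b)) (div_ne_zero hv hu), ?_⟩
      refine mk_eq_mk_iff_smul.2 ⟨a + b, ?_⟩
      change _ = (a + b) • (E + ((a + b * c.1) / (a + b)) • (1 - E))
      rw [hk', smul_add, smul_smul, mul_div_cancel₀ _ hu]
    · rintro ⟨d, hd⟩
      rw [← hd]
      change ProjGenLinGroup.mk (Units.map (splitHom E hE) d) ∈ _
      rw [mk_mem_torus]
      simp only [Units.coe_map]
      rw [← map_mul, ← map_mul, mul_comm]

theorem splitTorus_one_sub {E : Matrix (Fin 2) (Fin 2) F} (hE : E * E = E)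
    (hE' : (1 - E) * (1 - E) = 1 - E) (c : Fˣ) :
    splitTorus (1 - E) hE' c⁻¹ = splitTorus E hE c := by
  symm
  rw [splitTorus_eq_iff]
  refine ⟨(c⁻¹ : Fˣ), ?_⟩
  rw [smul_add, smul_smul, Units.inv_mul]
  module

/-- The matrix `B` satisfies two quadratic equations; since it is not scalar their coefficients
agree: `1 + c' = u(1 + c)` and `c' = u²c`. Hence `(1 - u)(1 - uc) = 0`: the eigenvalues are either
kept or exchanged. -/
theorem eq_or_eq_of_splitTorus_eq {E E' : Matrix (Fin 2) (Fin 2) F} {hE : E * E = E}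
    {hE' : E' * E' = E'} (h0' : E' ≠ 0) (h1' : E' ≠ 1)
    {c c' : Fˣ} (hc' : c' ≠ 1) (h : splitTorus E hE c = splitTorus E' hE' c') :
    (E' = E ∧ c' = c) ∨ (E' = 1 - E ∧ c' = c⁻¹) := by
  obtain ⟨u, hu⟩ := splitTorus_eq_iff.1 h
  have hc1 : c'.1 ≠ 1 := by simpa using hc'
  set B := E' + c'.1 • (1 - E') with hB
  have hns : ¬ ∃ u : F, B = u • 1 := not_scalar_split hE' h0' h1' hc1
  have hB1 : B * B = (1 + c'.1) • B - c'.1 • 1 := by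
    rw [hB]
    simp only [mul_add, add_mul, mul_sub, sub_mul, Matrix.smul_mul, Matrix.mul_smul, hE', mul_one,
      one_mul]
    module
  have hB2 : B * B = (u * (1 + c.1)) • B - (u * u * c.1) • 1 := by
    rw [hu]
    simp only [mul_add, add_mul, mul_sub, sub_mul, Matrix.smul_mul, Matrix.mul_smul, hE, mul_one,
      one_mul]
    module
  obtain ⟨e1, e2⟩ := eq_zero_of_smul_one_add_smul_eq_zero hns
    (a := u * u * c.1 - c'.1) (b := 1 + c'.1 - u * (1 + c.1)) (by
      have := hB1.symm.trans hB2
      rw [← sub_eq_zero] at this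
      rw [← this]
      module)
  have hprod : (1 - u) * (1 - u * c.1) = 0 := by linear_combination e1 + e2
  have hcc : 1 - c'.1 ≠ 0 := sub_ne_zero.2 hc1.symm
  rcases mul_eq_zero.1 hprod with h3 | h3
  · left
    have hu1 : u = 1 := (sub_eq_zero.1 h3).symm
    subst hu1
    have hc : c'.1 = c.1 := by linear_combination -e1
    refine ⟨?_, Units.ext hc⟩
    have : (1 - c'.1) • (E' - E) = 0 := by
      rw [hB, ← hc, ← sub_eq_zero] at hu
      rw [← hu]
      module
    exact sub_eq_zero.1 ((smul_eq_zero.1 this).resolve_left hcc)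
  · right
    have hu1 : u * c.1 = 1 := (sub_eq_zero.1 h3).symm
    have hcu : c'.1 = u := by linear_combination -e1 + u * hu1
    refine ⟨?_, Units.ext ?_⟩
    · have : (1 - c'.1) • (E' - (1 - E)) = 0 := by
        rw [hB, smul_add, smul_smul, hu1, ← hcu, ← sub_eq_zero] at hu
        rw [← hu]
        module
      exact sub_eq_zero.1 ((smul_eq_zero.1 this).resolve_left hcc)
    · rw [hcu, Units.val_inv_eq_inv_val]
      exact eq_inv_of_mul_eq_one_left hu1

/-! ### Unipotent elements -/

/-- The unipotent matrix `1 + N`, where `N ^ 2 = 0`. -/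
def unipotent (N : Matrix (Fin 2) (Fin 2) F) (hN : N * N = 0) : GL (Fin 2) F where
  val := 1 + N
  inv := 1 - N
  val_inv := by simp [add_mul, mul_sub, hN]
  inv_val := by simp [sub_mul, mul_add, hN]

theorem not_scalar_nilpotent {N : Matrix (Fin 2) (Fin 2) F} (hN : N * N = 0) (h0 : N ≠ 0) :
    ¬ ∃ u : F, N = u • 1 := by
  rintro ⟨u, rfl⟩
  have h := congrFun (congrFun hN 0) 0
  simp only [Matrix.smul_mul, one_mul, Matrix.smul_apply, Matrix.one_apply_eq, smul_eq_mul,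
    mul_one, Matrix.zero_apply] at h
  exact h0 (by rw [mul_self_eq_zero.1 h, zero_smul])

theorem mk_unipotent_ne_one {N : Matrix (Fin 2) (Fin 2) F} (hN : N * N = 0) (h0 : N ≠ 0) :
    ProjGenLinGroup.mk (unipotent N hN) ≠ 1 := by
  rw [Ne, mk_eq_one_iff_smul]
  rintro ⟨u, hu⟩
  refine not_scalar_nilpotent hN h0 ⟨u - 1, ?_⟩
  have hu' : 1 + N = u • (1 : Matrix (Fin 2) (Fin 2) F) := hu
  rw [sub_smul, ← hu', one_smul, add_sub_cancel_left]

theorem one_add_pow_char (p : ℕ) [hp : Fact p.Prime] [CharP F p] {N : Matrix (Fin 2) (Fin 2) F}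
    (hN : N * N = 0) : (1 + N) ^ p = 1 := by
  rw [add_pow_char_of_commute p (Commute.one_left N), one_pow]
  obtain ⟨k, hk⟩ := Nat.exists_eq_add_of_le hp.out.two_le
  rw [hk, pow_add, pow_two, hN, zero_mul, add_zero]

theorem orderOf_mk_unipotent (p : ℕ) [Fact p.Prime] [CharP F p] {N : Matrix (Fin 2) (Fin 2) F}
    (hN : N * N = 0) (h0 : N ≠ 0) : orderOf (ProjGenLinGroup.mk (unipotent N hN)) = p := by
  refine orderOf_eq_prime ?_ (mk_unipotent_ne_one hN h0)
  rw [← map_pow]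
  have : unipotent N hN ^ p = 1 := Units.ext (one_add_pow_char p hN)
  rw [this, map_one]

/-- Raising to the power `p` kills both unipotents, so the scalar relating them satisfies `u ^ p =
1`, hence `u = 1` in characteristic `p`. -/
theorem mk_unipotent_injective (p : ℕ) [hp : Fact p.Prime] [CharP F p]
    {N N' : Matrix (Fin 2) (Fin 2) F} {hN : N * N = 0} {hN' : N' * N' = 0}
    (h : ProjGenLinGroup.mk (unipotent N hN) = ProjGenLinGroup.mk (unipotent N' hN')) :
    N = N' := by
  obtain ⟨u, hu⟩ := mk_eq_mk_iff_smul.1 h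
  have hu' : 1 + N' = u • (1 + N) := hu
  have h1 := congrArg (· ^ p) hu'
  simp only [smul_pow, one_add_pow_char p hN, one_add_pow_char p hN'] at h1
  have h2 := congrFun (congrFun h1 0) 0
  simp only [Matrix.smul_apply, Matrix.one_apply_eq, smul_eq_mul, mul_one] at h2
  have h3 : u = 1 := by
    have h4 : (u - 1) ^ p = 0 := by rw [sub_pow_char, one_pow, ← h2, sub_self]
    exact sub_eq_zero.1 (pow_eq_zero_iff hp.out.ne_zero |>.1 h4)
  rw [h3, one_smul] at hu'
  exact (add_left_cancel hu').symm

/-! ### Nonsplit tori -/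

theorem mul_self_eq_smul_one_add_smul (A : Matrix (Fin 2) (Fin 2) F) :
    A * A = (-A.det) • 1 + A.trace • A := by
  ext i j
  fin_cases i <;> fin_cases j <;>
    simp [Matrix.mul_apply, Fin.sum_univ_two, Matrix.det_fin_two, Matrix.trace_fin_two] <;> ring

/-- Without eigenvalues in `F`, the algebra `F[A]` is a field `K` with `q²` elements. The torus is
the quotient of the cyclic group of units of `K` by that of `F`, of order `(q² - 1) / (q - 1)`. -/
theorem torus_of_irreducible [Finite F] (q : ℕ) (hq : Nat.card F = q) (g : GL (Fin 2) F)
    (hirr : ∀ r : F, r ^ 2 ≠ -(g : Matrix (Fin 2) (Fin 2) F).det +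
      (g : Matrix (Fin 2) (Fin 2) F).trace * r) :
    IsCyclic (torus g) ∧ Nat.card (torus g) = q + 1 := by
  have := Fact.mk hirr
  set A := (g : Matrix (Fin 2) (Fin 2) F) with hA
  set K := QuadraticAlgebra F (-A.det) A.trace with hK
  have hns : ¬ ∃ u : F, A = u • 1 := by
    rintro ⟨u, hu⟩
    refine hirr u ?_
    rw [hu]
    simp only [Matrix.det_fin_two, Matrix.trace_fin_two, Matrix.smul_apply, Matrix.one_apply,
      smul_eq_mul]
    simp
    ring
  let ρ : K →ₐ[F] Matrix (Fin 2) (Fin 2) F :=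
    QuadraticAlgebra.lift ⟨A, mul_self_eq_smul_one_add_smul A⟩
  have hρ : ∀ z : K, ρ z = z.re • 1 + z.im • A := by
    intro z
    simp [ρ, QuadraticAlgebra.lift]
  let ψ : Kˣ →* PGL(2, F) := ProjGenLinGroup.mk.comp (Units.map ρ.toMonoidHom)
  have hψ : ψ.range = torus g := by
    ext x
    induction x using ProjGenLinGroup.induction_on with
    | mk k =>
      rw [mk_mem_torus]
      constructor
      · rintro ⟨z, hz⟩
        have h1 : ProjGenLinGroup.mk (Units.map ρ.toMonoidHom z) ∈ torus g := by
          rw [mk_mem_torus]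
          change ρ z.1 * A = A * ρ z.1
          rw [hρ]
          simp [add_mul, mul_add]
        rw [← mk_mem_torus, ← hz]
        exact h1
      · intro hk
        obtain ⟨a, b, hab⟩ := exists_smul_one_add_smul_of_commute hns hk
        have hz : (⟨a, b⟩ : K) ≠ 0 := by
          intro hz
          have h1 : ρ ⟨a, b⟩ = 0 := by rw [hz, map_zero]
          rw [hρ, ← hab] at h1
          exact k.ne_zero h1
        refine ⟨Units.mk0 ⟨a, b⟩ hz, ?_⟩
        change ProjGenLinGroup.mk _ = _
        congr 1
        refine Units.ext ?_
        change ρ ⟨a, b⟩ = _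
        rw [hρ, ← hab]
  have hKfin : Finite K := Finite.of_equiv _ (QuadraticAlgebra.equivProd _ _).symm
  have hKcard : Nat.card K = q * q := by
    rw [Nat.card_congr (QuadraticAlgebra.equivProd (-A.det) A.trace), Nat.card_prod, hq]
  have hker : ψ.ker = (Units.map (algebraMap F K).toMonoidHom).range := by
    ext z
    rw [MonoidHom.mem_ker]
    change ProjGenLinGroup.mk _ = 1 ↔ _
    rw [mk_eq_one_iff_smul]
    change (∃ u : F, ρ z.1 = u • 1) ↔ _
    rw [hρ]
    constructor
    · rintro ⟨u, hu⟩
      obtain ⟨h1, h2⟩ := eq_zero_of_smul_one_add_smul_eq_zero hns (a := z.1.re - u) (b := z.1.im)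
        (by rw [← sub_eq_zero] at hu; rw [← hu]; module)
      have hz : z.1 = algebraMap F K u := by
        ext
        · exact sub_eq_zero.1 h1
        · exact h2
      have hu0 : u ≠ 0 := by
        rintro rfl
        exact z.ne_zero (by rw [hz, map_zero])
      exact ⟨Units.mk0 u hu0, Units.ext hz.symm⟩
    · rintro ⟨u, rfl⟩
      refine ⟨u.1, ?_⟩
      change (algebraMap F K u.1).re • (1 : Matrix (Fin 2) (Fin 2) F) +
        (algebraMap F K u.1).im • A = _
      rw [QuadraticAlgebra.algebraMap_re, QuadraticAlgebra.algebraMap_im, zero_smul, add_zero]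
  refine ⟨?_, ?_⟩
  · rw [← hψ]
    exact isCyclic_of_surjective ψ.rangeRestrict ψ.rangeRestrict_surjective
  · have hq1 : 1 < q := hq ▸ Finite.one_lt_card
    have h1 : Nat.card ψ.ker = q - 1 := by
      rw [hker, ← hq, ← Nat.card_units F]
      exact (Nat.card_congr (MonoidHom.ofInjective
        (Units.map_injective (algebraMap F K).injective)).toEquiv).symm
    have h2 := Subgroup.card_mul_index ψ.ker
    rw [Subgroup.index_ker, hψ, h1, Nat.card_units, hKcard] at h2
    obtain ⟨r, rfl⟩ : ∃ r, q = r + 2 := ⟨q - 2, by omega⟩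
    have h3 : (r + 2) * (r + 2) - 1 = (r + 2 - 1) * (r + 2 + 1) := by
      have : (r + 2) * (r + 2) = (r + 1) * (r + 3) + 1 := by ring
      rw [this]
      rfl
    rw [h3] at h2
    exact Nat.eq_of_mul_eq_mul_left (by omega) h2

/-! ### Classification of the nontrivial elements -/

theorem split_or_unipotent_or_irreducible (g : GL (Fin 2) F) (hg : ProjGenLinGroup.mk g ≠ 1) :
    (∃ (E : Matrix (Fin 2) (Fin 2) F) (hE : E * E = E) (c : Fˣ), E ≠ 0 ∧ E ≠ 1 ∧ c ≠ 1 ∧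
      ProjGenLinGroup.mk g = splitTorus E hE c) ∨
    (∃ (N : Matrix (Fin 2) (Fin 2) F) (hN : N * N = 0), N ≠ 0 ∧
      ProjGenLinGroup.mk g = ProjGenLinGroup.mk (unipotent N hN)) ∨
    ∀ r : F, r ^ 2 ≠ -(g : Matrix (Fin 2) (Fin 2) F).det +
      (g : Matrix (Fin 2) (Fin 2) F).trace * r := by
  by_cases h : ∀ r : F, r ^ 2 ≠ -(g : Matrix (Fin 2) (Fin 2) F).det +
      (g : Matrix (Fin 2) (Fin 2) F).trace * r
  · exact Or.inr (Or.inr h)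
  push Not at h
  obtain ⟨a, ha⟩ := h
  rw [Ne, mk_eq_one_iff_smul] at hg
  set A := (g : Matrix (Fin 2) (Fin 2) F) with hA
  have hdet : A.det ≠ 0 := ((Matrix.isUnit_iff_isUnit_det A).1 g.isUnit).ne_zero
  set b := A.trace - a with hb
  have hab : a * b = A.det := by rw [hb]; linear_combination -ha
  have ha0 : a ≠ 0 := by rintro rfl; exact hdet (by rw [← hab, zero_mul])
  have hb0 : b ≠ 0 := by intro hb0; exact hdet (by rw [← hab, hb0, mul_zero])
  have hAA : A * A = (-(a * b)) • 1 + (a + b) • A := by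
    rw [mul_self_eq_smul_one_add_smul, hab, hb]
    congr 2
    ring
  by_cases hne : a = b
  · right; left
    rw [← hne] at hAA
    have hsq : (A - a • 1) * (A - a • 1) = 0 := by
      simp only [mul_sub, sub_mul, Matrix.smul_mul, Matrix.mul_smul, mul_one, one_mul, hAA]
      module
    have hN : (a⁻¹ • (A - a • 1)) * (a⁻¹ • (A - a • 1)) = 0 := by
      rw [Matrix.smul_mul, Matrix.mul_smul, hsq, smul_zero, smul_zero]
    refine ⟨a⁻¹ • (A - a • 1), hN, ?_, ?_⟩
    · intro h0
      exact hg ⟨a, sub_eq_zero.1 ((smul_eq_zero.1 h0).resolve_left (inv_ne_zero ha0))⟩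
    · refine mk_eq_mk_iff_smul.2 ⟨a⁻¹, ?_⟩
      change 1 + a⁻¹ • (A - a • 1) = a⁻¹ • A
      rw [smul_sub, smul_smul, inv_mul_cancel₀ ha0, one_smul, add_sub_cancel]
  · left
    have hd : a - b ≠ 0 := sub_ne_zero.2 hne
    have hsq : (A - b • 1) * (A - b • 1) = (a - b) • (A - b • 1) := by
      simp only [mul_sub, sub_mul, Matrix.smul_mul, Matrix.mul_smul, mul_one, one_mul, hAA]
      module
    set E := (a - b)⁻¹ • (A - b • 1) with hEdef
    have hAE : A = b • 1 + (a - b) • E := by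
      rw [hEdef, smul_smul, mul_inv_cancel₀ hd, one_smul, add_sub_cancel]
    have hE : E * E = E := by
      rw [hEdef, Matrix.smul_mul, Matrix.mul_smul, hsq, smul_smul (a - b)⁻¹ (a - b),
        inv_mul_cancel₀ hd, one_smul]
    -- The matrix `E` projects onto the `a`-eigenspace; dividing `A` by `a` makes that eigenvalue
    -- `1` and the other one `b / a`.
    refine ⟨E, hE, Units.mk0 (b / a) (div_ne_zero hb0 ha0), ?_, ?_, ?_, ?_⟩
    · intro h0
      exact hg ⟨b, by rw [hAE, h0, smul_zero, add_zero]⟩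
    · intro h1
      exact hg ⟨a, by rw [hAE, h1]; module⟩
    · intro h1
      have h2 : b / a = 1 := congrArg Units.val h1
      exact hne ((div_eq_one_iff_eq ha0).1 h2).symm
    · refine mk_eq_mk_iff_smul.2 ⟨a⁻¹, ?_⟩
      change E + (b / a) • (1 - E) = a⁻¹ • A
      have h1 : E = (a⁻¹ * a) • E := by rw [inv_mul_cancel₀ ha0, one_smul]
      rw [hAE, div_eq_inv_mul]
      nth_rewrite 1 [h1]
      module

end Tori

/-! ### Counting nilpotents, idempotents, split elements and the whole group. -/

section Counting

theorem card_mul_eq {F : Type*} [Field F] [Fintype F] [DecidableEq F] (d : F) :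
    Fintype.card {x : F × F // x.1 * x.2 = d} =
      if d = 0 then 2 * Fintype.card F - 1 else Fintype.card F - 1 := by
  have hpos : 0 < Fintype.card F := Fintype.card_pos
  have h1 : Fintype.card {x : F × F // x.1 * x.2 = d} =
      ∑ b : F, Fintype.card {c : F // b * c = d} := by
    rw [← Fintype.card_sigma]
    exact Fintype.card_congr
      { toFun := fun x => ⟨x.1.1, x.1.2, x.2⟩
        invFun := fun x => ⟨(x.1, x.2.1), x.2.2⟩
        left_inv := fun _ => rfl
        right_inv := fun _ => rfl }
  have h2 : ∀ b : F, b ≠ 0 → Fintype.card {c : F // b * c = d} = 1 := by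
    intro b hb
    rw [Fintype.card_eq_one_iff]
    refine ⟨⟨d / b, mul_div_cancel₀ _ hb⟩, fun y => Subtype.ext ?_⟩
    rw [eq_div_iff hb, mul_comm]
    exact y.2
  have h3 : Fintype.card {c : F // (0 : F) * c = d} = if d = 0 then Fintype.card F else 0 := by
    split_ifs with hd
    · subst hd
      simp
    · rw [Fintype.card_eq_zero_iff]
      exact ⟨fun c => hd (by simpa using c.2.symm)⟩
  rw [h1, ← Finset.add_sum_erase _ _ (Finset.mem_univ (0 : F)), h3,
    Finset.sum_congr rfl fun b hb => h2 b (Finset.ne_of_mem_erase hb), Finset.sum_const,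
    Finset.card_erase_of_mem (Finset.mem_univ _), Finset.card_univ]
  split_ifs
  · simp only [smul_eq_mul, mul_one]
    omega
  · simp

theorem card_mul_eq_apply {F : Type*} [Field F] [Fintype F] [DecidableEq F] (f : F → F) :
    Fintype.card {x : F × F × F // x.2.1 * x.2.2 = f x.1} =
      ∑ a : F, if f a = 0 then 2 * Fintype.card F - 1 else Fintype.card F - 1 := by
  rw [← Finset.sum_congr rfl fun a _ => card_mul_eq (f a), ← Fintype.card_sigma]
  exact Fintype.card_congr
    { toFun := fun x => ⟨x.1.1, x.1.2, x.2⟩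
      invFun := fun x => ⟨(x.1, x.2.1), x.2.2⟩
      left_inv := fun _ => rfl
      right_inv := fun _ => rfl }

variable {F : Type*} [Field F]

/-- The matrices of trace `s` with given entries. -/
def matrixOfTrace (s : F) (x : F × F × F) : Matrix (Fin 2) (Fin 2) F :=
  !![x.1, x.2.1; x.2.2, s - x.1]

theorem matrixOfTrace_mul_self {s : F} {x : F × F × F} (hx : x.2.1 * x.2.2 = x.1 * (s - x.1)) :
    matrixOfTrace s x * matrixOfTrace s x = s • matrixOfTrace s x := by
  ext i j
  fin_cases i <;> fin_cases j <;>
    simp [matrixOfTrace, Matrix.mul_apply, Fin.sum_univ_two]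
  · linear_combination hx
  · ring
  · ring
  · linear_combination hx

theorem matrixOfTrace_of_trace {s : F} {A : Matrix (Fin 2) (Fin 2) F} (hA : A.trace = s) :
    matrixOfTrace s (A 0 0, A 0 1, A 1 0) = A := by
  rw [← hA]
  ext i j
  fin_cases i <;> fin_cases j <;> simp [matrixOfTrace, Matrix.trace_fin_two]

theorem matrixOfTrace_injective (s : F) : Function.Injective (matrixOfTrace s) := by
  rintro ⟨a, b, c⟩ ⟨a', b', c'⟩ h
  have h00 := congrFun (congrFun h 0) 0
  have h01 := congrFun (congrFun h 0) 1
  have h10 := congrFun (congrFun h 1) 0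
  simp only [matrixOfTrace, Matrix.of_apply, Matrix.cons_val', Matrix.cons_val_zero,
    Matrix.cons_val_one, Matrix.cons_val_fin_one] at h00 h01 h10
  rw [h00, h01, h10]

/-- Such a matrix has trace `0`, and the condition becomes `bc = -a²`: `2q - 1` solutions for `a =
0` and `q - 1` for each other `a`. -/
theorem card_nilpotent [Finite F] :
    Nat.card {N : Matrix (Fin 2) (Fin 2) F // N * N = 0} = Nat.card F ^ 2 := by
  classical
  have := Fintype.ofFinite F
  let f : {x : F × F × F // x.2.1 * x.2.2 = x.1 * (0 - x.1)} →
      {N : Matrix (Fin 2) (Fin 2) F // N * N = 0} := fun x =>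
    ⟨matrixOfTrace 0 x.1, by rw [matrixOfTrace_mul_self x.2, zero_smul]⟩
  have hf : Function.Bijective f := by
    refine ⟨fun x y h => Subtype.ext (matrixOfTrace_injective 0 (Subtype.ext_iff.1 h)), ?_⟩
    rintro ⟨N, hN⟩
    have htr : N.trace = 0 := by
      by_cases h0 : N = 0
      · rw [h0, Matrix.trace_zero]
      · have h1 := mul_self_eq_smul_one_add_smul N
        rw [hN] at h1
        exact (eq_zero_of_smul_one_add_smul_eq_zero (not_scalar_nilpotent hN h0) h1.symm).2
    have h00 := congrFun (congrFun hN 0) 0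
    simp only [Matrix.mul_apply, Fin.sum_univ_two, Matrix.zero_apply] at h00
    exact ⟨⟨(N 0 0, N 0 1, N 1 0), by linear_combination h00⟩,
      Subtype.ext (matrixOfTrace_of_trace htr)⟩
  rw [← Nat.card_congr (Equiv.ofBijective f hf), Nat.card_eq_fintype_card,
    card_mul_eq_apply fun a : F => a * (0 - a), Nat.card_eq_fintype_card]
  have h1 : ∀ a : F, a * (0 - a) = 0 ↔ a = 0 := fun a => by simp
  simp only [h1]
  rw [← Finset.add_sum_erase _ _ (Finset.mem_univ (0 : F)), if_pos rfl,
    Finset.sum_congr rfl fun b hb => if_neg (Finset.ne_of_mem_erase hb), Finset.sum_const,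
    Finset.card_erase_of_mem (Finset.mem_univ _), Finset.card_univ]
  obtain ⟨r, hr⟩ : ∃ r, Fintype.card F = r + 1 := ⟨Fintype.card F - 1, by
    have : 0 < Fintype.card F := Fintype.card_pos
    omega⟩
  rw [hr]
  have : 2 * (r + 1) - 1 = 2 * r + 1 := by omega
  rw [this, Nat.add_sub_cancel, smul_eq_mul]
  ring

/-- Such a matrix has trace `1`, and the condition becomes `bc = a(1 - a)`: `2q - 1` solutions for
`a = 0` and for `a = 1`, and `q - 1` for each other `a`. -/
theorem card_idempotent [Finite F] :
    Nat.card {E : Matrix (Fin 2) (Fin 2) F // E * E = E ∧ E ≠ 0 ∧ E ≠ 1} =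
      Nat.card F ^ 2 + Nat.card F := by
  classical
  have := Fintype.ofFinite F
  let f : {x : F × F × F // x.2.1 * x.2.2 = x.1 * (1 - x.1)} →
      {E : Matrix (Fin 2) (Fin 2) F // E * E = E ∧ E ≠ 0 ∧ E ≠ 1} := fun x =>
    ⟨matrixOfTrace 1 x.1, by rw [matrixOfTrace_mul_self x.2, one_smul], by
      intro h
      have h1 := congrFun (congrFun h 0) 0
      have h2 := congrFun (congrFun h 1) 1
      simp [matrixOfTrace] at h1 h2
      simp [h1] at h2, by
      intro h
      have h1 := congrFun (congrFun h 0) 0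
      have h2 := congrFun (congrFun h 1) 1
      simp [matrixOfTrace] at h1 h2
      simp [h1] at h2⟩
  have hf : Function.Bijective f := by
    refine ⟨fun x y h => Subtype.ext (matrixOfTrace_injective 1 (Subtype.ext_iff.1 h)), ?_⟩
    rintro ⟨E, hE, h0, h1⟩
    have htr : E.trace = 1 := by
      have h2 := mul_self_eq_smul_one_add_smul E
      rw [hE] at h2
      have h3 : (-E.det) • (1 : Matrix (Fin 2) (Fin 2) F) + (E.trace - 1) • E = 0 := by
        rw [sub_smul, one_smul, add_sub, ← h2, sub_self]
      exact sub_eq_zero.1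
        (eq_zero_of_smul_one_add_smul_eq_zero (not_scalar_idempotent hE h0 h1) h3).2
    have h00 := congrFun (congrFun hE 0) 0
    simp only [Matrix.mul_apply, Fin.sum_univ_two] at h00
    exact ⟨⟨(E 0 0, E 0 1, E 1 0), by linear_combination h00⟩,
      Subtype.ext (matrixOfTrace_of_trace htr)⟩
  rw [← Nat.card_congr (Equiv.ofBijective f hf), Nat.card_eq_fintype_card,
    card_mul_eq_apply fun a : F => a * (1 - a), Nat.card_eq_fintype_card]
  have h1 : ∀ a : F, a * (1 - a) = 0 ↔ a = 0 ∨ a = 1 := fun a => by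
    rw [mul_eq_zero, sub_eq_zero, eq_comm (a := (1 : F))]
  simp only [h1]
  have hmem : (1 : F) ∈ Finset.univ.erase (0 : F) := by simp
  rw [← Finset.add_sum_erase _ _ (Finset.mem_univ (0 : F)), ← Finset.add_sum_erase _ _ hmem,
    if_pos (Or.inl rfl), if_pos (Or.inr rfl),
    Finset.sum_congr rfl fun b hb => if_neg (by
      rw [Finset.mem_erase, Finset.mem_erase] at hb
      tauto), Finset.sum_const,
    Finset.card_erase_of_mem hmem, Finset.card_erase_of_mem (Finset.mem_univ _), Finset.card_univ]
  obtain ⟨r, hr⟩ : ∃ r, Fintype.card F = r + 2 := ⟨Fintype.card F - 2, by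
    have : 1 < Fintype.card F := Fintype.one_lt_card
    omega⟩
  rw [hr]
  have h2 : 2 * (r + 2) - 1 = 2 * r + 3 := by omega
  have h3 : r + 2 - 1 - 1 = r := by omega
  have h4 : r + 2 - 1 = r + 1 := by omega
  rw [h2, h3, h4, smul_eq_mul]
  ring

instance finite_PGL [Finite F] : Finite PGL(2, F) :=
  Finite.of_surjective _ (ProjGenLinGroup.mk_surjective (n := Fin 2) (R := F))

theorem card_PGL [Finite F] : Nat.card PGL(2, F) = Nat.card F ^ 3 - Nat.card F := by
  classical
  have := Fintype.ofFinite F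
  have h1 := Subgroup.card_mul_index (ProjGenLinGroup.mk (n := Fin 2) (R := F)).ker
  have h2 : (ProjGenLinGroup.mk (n := Fin 2) (R := F)).range = ⊤ :=
    MonoidHom.range_eq_top.2 ProjGenLinGroup.mk_surjective
  have h3 : Nat.card (ProjGenLinGroup.mk (n := Fin 2) (R := F)).ker = Nat.card F - 1 := by
    rw [ProjGenLinGroup.ker_mk, GeneralLinearGroup.center_eq_range_scalar, ← Nat.card_units F]
    refine (Nat.card_congr (MonoidHom.ofInjective
      (f := GeneralLinearGroup.scalar (Fin 2)) ?_).toEquiv).symm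
    intro u w h
    have := congrArg (fun g : GL (Fin 2) F => (g : Matrix (Fin 2) (Fin 2) F) 0 0) h
    simpa [Units.ext_iff] using this
  rw [Subgroup.index_ker, h2, Subgroup.card_top, h3, card_GL_field, Fin.prod_univ_two,
    ← Nat.card_eq_fintype_card] at h1
  have hpos : 1 < Nat.card F := Finite.one_lt_card
  obtain ⟨r, hr⟩ : ∃ r, Nat.card F = r + 2 := ⟨Nat.card F - 2, by omega⟩
  rw [hr] at h1 ⊢
  have e1 : (r + 2) ^ 2 = (r + 1) * (r + 3) + 1 := by ring
  have e2 : (r + 2) ^ 2 = (r + 1) * (r + 2) + (r + 2) := by ring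
  have e3 : (r + 2) ^ 3 = (r + 3) * ((r + 1) * (r + 2)) + (r + 2) := by ring
  have e4 : r + 2 - 1 = r + 1 := rfl
  simp only [Fin.val_zero, pow_zero, Fin.val_one, pow_one, e4] at h1
  rw [show (r + 2) ^ 2 - 1 = (r + 1) * (r + 3) by omega,
    show (r + 2) ^ 2 - (r + 2) = (r + 1) * (r + 2) by omega, mul_assoc] at h1
  rw [Nat.eq_of_mul_eq_mul_left (by omega) h1, e3, Nat.add_sub_cancel]

/-- `x` is the class of a matrix with two distinct eigenvalues in `F`. -/
def IsSplit (x : PGL(2, F)) : Prop :=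
  ∃ (E : Matrix (Fin 2) (Fin 2) F) (hE : E * E = E) (c : Fˣ), E ≠ 0 ∧ E ≠ 1 ∧ c ≠ 1 ∧
    x = splitTorus E hE c

/-- The map from pairs `(E, c)` to split elements is two-to-one, the pairs `(E, c)` and `(1 - E,
c⁻¹)` giving the same element. -/
theorem two_mul_card_isSplit [Finite F] :
    2 * Nat.card {x : PGL(2, F) // IsSplit x} =
      (Nat.card F ^ 2 + Nat.card F) * (Nat.card F - 2) := by
  classical
  have := Fintype.ofFinite F
  have := Fintype.ofFinite PGL(2, F)
  let S := {E : Matrix (Fin 2) (Fin 2) F // E * E = E ∧ E ≠ 0 ∧ E ≠ 1} × {c : Fˣ // c ≠ 1}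
  have hS : Nat.card S = (Nat.card F ^ 2 + Nat.card F) * (Nat.card F - 2) := by
    rw [Nat.card_prod, card_idempotent]
    congr 1
    rw [Nat.card_eq_fintype_card, Fintype.card_subtype_compl, Fintype.card_subtype_eq,
      ← Nat.card_eq_fintype_card, Nat.card_units]
    omega
  let f : S → PGL(2, F) := fun a => splitTorus a.1.1 a.1.2.1 a.2.1
  have hmaps : ∀ a ∈ (Finset.univ : Finset S), f a ∈ Finset.univ.filter fun x => IsSplit x := by
    rintro ⟨⟨E, hE, h0, h1⟩, c, hc⟩ -
    simp only [Finset.mem_filter, Finset.mem_univ, true_and]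
    exact ⟨E, hE, c, h0, h1, hc, rfl⟩
  rw [← hS, Nat.card_eq_fintype_card, Nat.card_eq_fintype_card, Fintype.card_subtype,
    ← Finset.card_univ, Finset.card_eq_sum_card_fiberwise hmaps]
  rw [Finset.sum_congr rfl (g := fun _ => 2), Finset.sum_const, smul_eq_mul, mul_comm]
  intro x hx
  obtain ⟨E, hE, c, h0, h1, hc, rfl⟩ := (Finset.mem_filter.1 hx).2
  have hE' : (1 - E) * (1 - E) = 1 - E := by
    simp [mul_sub, sub_mul, hE]
  have h0' : (1 - E) ≠ 0 := fun h => h1 (sub_eq_zero.1 h).symm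
  have h1' : (1 - E) ≠ 1 := fun h => h0 (by simpa using h)
  have hc' : c⁻¹ ≠ 1 := by simpa using hc
  -- This argument works in characteristic 2 as well, so the two pairs in a fibre are always
  -- distinct, even when `c = c⁻¹`.
  have hne : E ≠ 1 - E := by
    intro h
    apply h0
    have : E * E = E * (1 - E) := by rw [← h]
    rwa [mul_sub, mul_one, hE, sub_self] at this
  rw [Finset.card_eq_two]
  refine ⟨(⟨E, hE, h0, h1⟩, ⟨c, hc⟩), (⟨1 - E, hE', h0', h1'⟩, ⟨c⁻¹, hc'⟩), ?_, ?_⟩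
  · intro h
    exact hne (congrArg (fun a : S => a.1.1) h)
  · ext ⟨⟨A, hA, hA0, hA1⟩, d, hd⟩
    simp only [Finset.mem_filter, Finset.mem_univ, true_and, Finset.mem_insert,
      Finset.mem_singleton, f]
    constructor
    · intro h
      rcases eq_or_eq_of_splitTorus_eq hA0 hA1 hd h.symm with ⟨rfl, rfl⟩ | ⟨rfl, rfl⟩
      · exact Or.inl rfl
      · exact Or.inr rfl
    · rintro (h | h)
      · cases h
        rfl
      · cases h
        exact splitTorus_one_sub hE hA c

end Counting

/-- The hypotheses make the subgroups `M x` partition the nontrivial elements; each one of order `n`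
accounts for `n - 1` of them. -/
theorem card_mul_pred_eq_card {G : Type*} [Group G] [Finite G] (M : G → Subgroup G)
    (h1 : ∀ x, x ≠ 1 → x ∈ M x) (h2 : ∀ x, x ≠ 1 → ∀ y ∈ M x, y ≠ 1 → M y = M x) (n : ℕ) :
    Nat.card {Z : {Z : Subgroup G // ∃ x, x ≠ 1 ∧ M x = Z} // Nat.card Z.1 = n} * (n - 1) =
      Nat.card {x : G // x ≠ 1 ∧ Nat.card (M x) = n} := by
  classical
  let I := {Z : {Z : Subgroup G // ∃ x, x ≠ 1 ∧ M x = Z} // Nat.card Z.1 = n}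
  have := Fintype.ofFinite G
  have := Fintype.ofFinite I
  have hM : ∀ (Z : I) (z : Z.1.1), z ≠ 1 → M z.1 = Z.1.1 := by
    rintro ⟨⟨_, x, hx, rfl⟩, hZ⟩ z hz
    exact h2 x hx z.1 z.2 (by simpa using hz)
  let f : (Σ Z : I, {z : Z.1.1 // z ≠ 1}) → {x : G // x ≠ 1 ∧ Nat.card (M x) = n} := fun a =>
    ⟨a.2.1.1, by simpa using a.2.2, by rw [hM a.1 a.2.1 a.2.2]; exact a.1.2⟩
  have hf : Function.Bijective f := by
    constructor
    · rintro ⟨Z, ⟨z, hzZ⟩, hz⟩ ⟨Z', ⟨z', hzZ'⟩, hz'⟩ h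
      have hzz : z = z' := congrArg Subtype.val h
      subst hzz
      have hZZ : Z = Z' := Subtype.ext (Subtype.ext
        ((hM Z ⟨z, hzZ⟩ hz).symm.trans (hM Z' ⟨z, hzZ'⟩ hz')))
      subst hZZ
      rfl
    · rintro ⟨x, hx, hxn⟩
      exact ⟨⟨⟨⟨M x, x, hx, rfl⟩, hxn⟩, ⟨⟨x, h1 x hx⟩, by simpa using hx⟩⟩, rfl⟩
  rw [← Nat.card_congr (Equiv.ofBijective f hf), Nat.card_sigma]
  have hcard : ∀ Z : I, Nat.card {z : Z.1.1 // z ≠ 1} = n - 1 := by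
    intro Z
    rw [Nat.card_eq_fintype_card, Fintype.card_subtype_compl, Fintype.card_subtype_eq,
      ← Nat.card_eq_fintype_card, Z.2]
  rw [Finset.sum_congr rfl fun Z _ => hcard Z, Finset.sum_const, Finset.card_univ, smul_eq_mul,
    Nat.card_eq_fintype_card]

/-! ### The partition of `PGL(2, F)` into cyclic subgroups. -/

section Partition

variable {F : Type*} [Field F]

open Classical in
/-- The cyclic subgroup through `x` in the partition of `PGL(2, F)`. -/
noncomputable def cyclicPart (p : ℕ) (x : PGL(2, F)) : Subgroup PGL(2, F) :=
  if orderOf x = p then Subgroup.zpowers x else torus (ProjGenLinGroup.mk_surjective x).choose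

/-- The definition picks an arbitrary lift of the class; all lifts have the same torus. -/
theorem cyclicPart_mk {p : ℕ} {g : GL (Fin 2) F} (hg : ProjGenLinGroup.mk g ≠ 1)
    (hp : orderOf (ProjGenLinGroup.mk g) ≠ p) : cyclicPart p (ProjGenLinGroup.mk g) = torus g := by
  have h := (ProjGenLinGroup.mk_surjective (ProjGenLinGroup.mk g)).choose_spec
  rw [cyclicPart, if_neg hp]
  refine torus_eq_of_mem hg (by rwa [h]) ?_
  rw [h, mk_mem_torus]

theorem mem_cyclicPart (p : ℕ) (x : PGL(2, F)) (hx : x ≠ 1) : x ∈ cyclicPart p x := by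
  induction x using ProjGenLinGroup.induction_on with
  | mk g =>
    by_cases hp : orderOf (ProjGenLinGroup.mk g) = p
    · rw [cyclicPart, if_pos hp]
      exact Subgroup.mem_zpowers _
    · rw [cyclicPart_mk hx hp, mk_mem_torus]

theorem IsSplit.cyclicPart [Finite F] (p q : ℕ) [hp : Fact p.Prime]
    (hpq : p ∣ q) (hF : Nat.card F = q) {x : PGL(2, F)} (hx : IsSplit x) :
    IsCyclic (cyclicPart p x) ∧ Nat.card (cyclicPart p x) = q - 1 ∧ orderOf x ≠ p := by
  have hq1 : 1 < q := hF ▸ Finite.one_lt_card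
  obtain ⟨E, hE, c, h0, h1, hc, rfl⟩ := hx
  have hne := splitTorus_ne_one hE h0 h1 hc
  have ho : orderOf (splitTorus E hE c) ≠ p := by
    rw [orderOf_injective _ (splitTorus_injective hE h0 h1)]
    intro h
    have h2 : p ∣ q - 1 := by
      rw [← h, ← hF, ← Nat.card_units]
      exact orderOf_dvd_natCard c
    have h3 := (Nat.dvd_sub_iff_right hq1.le hpq).1 h2
    exact hp.out.one_lt.ne' (Nat.dvd_one.1 h3)
  have ht : PowerMapGraph.cyclicPart p (splitTorus E hE c) = (splitTorus E hE).range := by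
    rw [← torus_splitTorus hE h0 h1 hc]
    exact cyclicPart_mk hne ho
  rw [ht]
  refine ⟨isCyclic_of_surjective _ (splitTorus E hE).rangeRestrict_surjective, ?_, ho⟩
  rw [← hF, ← Nat.card_units]
  exact (Nat.card_congr (MonoidHom.ofInjective (splitTorus_injective hE h0 h1)).toEquiv).symm

/-- Unipotents have order `p`, while tori have order `q ± 1`, prime to `p`. So the branch on the
order in `cyclicPart` isolates exactly the unipotent classes. -/
theorem cyclicPart_trichotomy [Finite F] (p q : ℕ) [hp : Fact p.Prime] [CharP F p]
    (hpq : p ∣ q) (hF : Nat.card F = q) (x : PGL(2, F)) (hx : x ≠ 1) :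
    IsCyclic (cyclicPart p x) ∧
      ((Nat.card (cyclicPart p x) = p ∧ orderOf x = p ∧ ∃ (N : Matrix (Fin 2) (Fin 2) F)
          (hN : N * N = 0), N ≠ 0 ∧ x = ProjGenLinGroup.mk (unipotent N hN)) ∨
        (Nat.card (cyclicPart p x) = q - 1 ∧ orderOf x ≠ p ∧ IsSplit x) ∨
        (Nat.card (cyclicPart p x) = q + 1 ∧ orderOf x ≠ p)) := by
  induction x using ProjGenLinGroup.induction_on with
  | mk g =>
    rcases split_or_unipotent_or_irreducible g hx with h | ⟨N, hN, h0, hg⟩ | h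
    · obtain ⟨h1, h2, h3⟩ := IsSplit.cyclicPart p q hpq hF h
      exact ⟨h1, Or.inr (Or.inl ⟨h2, h3, h⟩)⟩
    · have ho : orderOf (ProjGenLinGroup.mk g) = p := by
        rw [hg]
        exact orderOf_mk_unipotent p hN h0
      rw [cyclicPart, if_pos ho]
      exact ⟨inferInstance, Or.inl ⟨by rw [Nat.card_zpowers, ho], ho, N, hN, h0, hg⟩⟩
    · obtain ⟨h1, h2⟩ := torus_of_irreducible q hF g h
      have ho : orderOf (ProjGenLinGroup.mk g) ≠ p := by
        intro h3
        have h4 : p ∣ q + 1 := by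
          rw [← h2, ← h3]
          have hmem : ProjGenLinGroup.mk g ∈ torus g := by rw [mk_mem_torus]
          rw [← Subgroup.orderOf_mk _ hmem]
          exact orderOf_dvd_natCard _
        exact hp.out.one_lt.ne' (Nat.dvd_one.1 ((Nat.dvd_add_right hpq).1 h4))
      rw [cyclicPart_mk hx ho]
      exact ⟨h1, Or.inr (Or.inr ⟨h2, ho⟩)⟩

/-- Nontrivial elements of one part all have order `p` or all have another order, so both parts are
given by the same branch; then equality holds by primality of `p` or by `torus_eq_of_mem`. -/
theorem cyclicPart_eq_of_mem [Finite F] (p q : ℕ) [hp : Fact p.Prime] [CharP F p]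
    (hpq : p ∣ q) (hF : Nat.card F = q) (x : PGL(2, F)) (hx : x ≠ 1) (y : PGL(2, F))
    (hy : y ∈ cyclicPart p x) (hy1 : y ≠ 1) : cyclicPart p y = cyclicPart p x := by
  have hq1 : 1 < q := hF ▸ Finite.one_lt_card
  have hdvd : orderOf y ∣ Nat.card (cyclicPart p x) := by
    rw [← Subgroup.orderOf_mk y hy]
    exact orderOf_dvd_natCard _
  by_cases ho : orderOf x = p
  · have hx' : cyclicPart p x = Subgroup.zpowers x := if_pos ho
    rw [hx', Nat.card_zpowers, ho] at hdvd
    have hoy : orderOf y = p :=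
      ((Nat.dvd_prime hp.out).1 hdvd).resolve_left (by rwa [orderOf_eq_one_iff])
    have hy' : cyclicPart p y = Subgroup.zpowers y := if_pos hoy
    rw [hx', hy']
    rw [hx'] at hy
    refine Subgroup.eq_of_le_of_card_ge (by rwa [Subgroup.zpowers_le]) ?_
    rw [Nat.card_zpowers, Nat.card_zpowers, ho, hoy]
  · have hoy : orderOf y ≠ p := by
      rintro hoy
      rw [hoy] at hdvd
      rcases (cyclicPart_trichotomy p q hpq hF x hx).2 with h | h | h
      · exact ho h.2.1
      · rw [h.1] at hdvd
        exact hp.out.one_lt.ne'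
          (Nat.dvd_one.1 ((Nat.dvd_sub_iff_right hq1.le hpq).1 hdvd))
      · rw [h.1] at hdvd
        exact hp.out.one_lt.ne' (Nat.dvd_one.1 ((Nat.dvd_add_right hpq).1 hdvd))
    obtain ⟨g, rfl⟩ := ProjGenLinGroup.mk_surjective x
    obtain ⟨k, rfl⟩ := ProjGenLinGroup.mk_surjective y
    rw [cyclicPart_mk hx ho] at hy ⊢
    rw [cyclicPart_mk hy1 hoy]
    exact torus_eq_of_mem hx hy1 hy

theorem exists_partition [Finite F] (p q : ℕ) [hp : Fact p.Prime] [CharP F p]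
    (hpq : p ∣ q) (hF : Nat.card F = q) (hq : 3 ≤ q) :
    ∃ (H : {Z : Subgroup PGL(2, F) // ∃ x, x ≠ 1 ∧ cyclicPart p x = Z} → Subgroup PGL(2, F))
      (τ : {Z : Subgroup PGL(2, F) // ∃ x, x ≠ 1 ∧ cyclicPart p x = Z} → Fin 3),
      (∀ i, IsCyclic (H i)) ∧ (∀ i, Nat.card (H i) = ![q - 1, q + 1, p] (τ i)) ∧
      (∀ k, Nat.card {i // τ i = k} =
        ![q * (q + 1) / 2, q * (q - 1) / 2, (q ^ 2 - 1) / (p - 1)] k) ∧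
      (∀ g, g ≠ 1 → ∃ i, g ∈ H i) ∧
      (∀ g, g ≠ 1 → ∀ i j, g ∈ H i → g ∈ H j → i = j) := by
  classical
  have := Fintype.ofFinite PGL(2, F)
  have hp2 := hp.out.two_le
  have hne1 : p ≠ q - 1 := by
    rintro h
    have h3 := (Nat.dvd_sub_iff_right (by omega : 1 ≤ q) hpq).1 (h ▸ dvd_rfl)
    exact hp.out.one_lt.ne' (Nat.dvd_one.1 h3)
  have hne2 : p ≠ q + 1 := by
    rintro h
    exact hp.out.one_lt.ne' (Nat.dvd_one.1 ((Nat.dvd_add_right hpq).1 (h ▸ dvd_rfl)))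
  have htri := cyclicPart_trichotomy (F := F) p q hpq hF
  have hmem := mem_cyclicPart (F := F) p
  have heq := cyclicPart_eq_of_mem (F := F) p q hpq hF
  let ι := {Z : Subgroup PGL(2, F) // ∃ x, x ≠ 1 ∧ cyclicPart p x = Z}
  let τ : ι → Fin 3 := fun Z =>
    if Nat.card Z.1 = q - 1 then 0 else if Nat.card Z.1 = q + 1 then 1 else 2
  have hcases : ∀ Z : ι, Nat.card Z.1 = p ∨ Nat.card Z.1 = q - 1 ∨ Nat.card Z.1 = q + 1 := by
    rintro ⟨_, x, hx, rfl⟩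
    rcases (htri x hx).2 with h | h | h
    · exact Or.inl h.1
    · exact Or.inr (Or.inl h.1)
    · exact Or.inr (Or.inr h.1)
  have hτ : ∀ (Z : ι) (k : Fin 3), τ Z = k ↔ Nat.card Z.1 = ![q - 1, q + 1, p] k := by
    intro Z k
    simp only [τ]
    rcases hcases Z with h | h | h
    · rw [h, if_neg hne1, if_neg hne2]
      fin_cases k <;> simp [hne1, hne2]
    · rw [h, if_pos rfl]
      fin_cases k <;> simp [hne1.symm]
    · rw [h, if_neg (by omega), if_pos rfl]
      fin_cases k <;> simp [hne2.symm]
      omega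
  have hcount : ∀ k, Nat.card {i : ι // τ i = k} * (![q - 1, q + 1, p] k - 1) =
      Nat.card {x : PGL(2, F) // x ≠ 1 ∧ Nat.card (cyclicPart p x) = ![q - 1, q + 1, p] k} := by
    intro k
    rw [← card_mul_pred_eq_card (cyclicPart p) hmem heq]
    congr 1
    exact Nat.card_congr (Equiv.subtypeEquivRight fun Z => hτ Z k)
  have hsplit : Nat.card {x : PGL(2, F) // x ≠ 1 ∧ Nat.card (cyclicPart p x) = q - 1} =
      Nat.card {x : PGL(2, F) // IsSplit x} := by
    refine Nat.card_congr (Equiv.subtypeEquivRight fun x => ?_)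
    constructor
    · rintro ⟨hx, h⟩
      rcases (htri x hx).2 with h' | h' | h'
      · omega
      · exact h'.2.2
      · omega
    · intro hs
      refine ⟨?_, (IsSplit.cyclicPart p q hpq hF hs).2.1⟩
      obtain ⟨E, hE, c, h0, h1, hc, rfl⟩ := hs
      exact splitTorus_ne_one hE h0 h1 hc
  have hunip : Nat.card {x : PGL(2, F) // x ≠ 1 ∧ Nat.card (cyclicPart p x) = p} = q ^ 2 - 1 := by
    let f : {N : {N : Matrix (Fin 2) (Fin 2) F // N * N = 0} // N ≠ ⟨0, mul_zero 0⟩} →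
        {x : PGL(2, F) // x ≠ 1 ∧ Nat.card (cyclicPart p x) = p} := fun N =>
      have hN0 : N.1.1 ≠ 0 := fun h => N.2 (Subtype.ext h)
      ⟨ProjGenLinGroup.mk (unipotent N.1.1 N.1.2), mk_unipotent_ne_one N.1.2 hN0, by
        have ho := orderOf_mk_unipotent p N.1.2 hN0
        rw [cyclicPart, if_pos ho, Nat.card_zpowers, ho]⟩
    have hf : Function.Bijective f := by
      constructor
      · intro N N' h
        exact Subtype.ext (Subtype.ext (mk_unipotent_injective p (congrArg Subtype.val h)))
      · rintro ⟨x, hx, h⟩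
        rcases (htri x hx).2 with ⟨-, -, N, hN, h0, rfl⟩ | h' | h'
        · exact ⟨⟨⟨N, hN⟩, fun h => h0 (congrArg Subtype.val h)⟩, rfl⟩
        · exact absurd (h.symm.trans h'.1) hne1
        · exact absurd (h.symm.trans h'.1) hne2
    have := Fintype.ofFinite F
    rw [← Nat.card_congr (Equiv.ofBijective f hf), Nat.card_eq_fintype_card,
      Fintype.card_subtype_compl, Fintype.card_subtype_eq, ← Nat.card_eq_fintype_card,
      card_nilpotent, hF]
  -- The nonsplit elements are not counted directly: they are what remains of the group.
  have htotal : Nat.card {x : PGL(2, F) // x ≠ 1 ∧ Nat.card (cyclicPart p x) = q - 1} +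
      Nat.card {x : PGL(2, F) // x ≠ 1 ∧ Nat.card (cyclicPart p x) = q + 1} +
      Nat.card {x : PGL(2, F) // x ≠ 1 ∧ Nat.card (cyclicPart p x) = p} + 1 =
      Nat.card PGL(2, F) := by
    have hfil : ∀ n, Nat.card {x : PGL(2, F) // x ≠ 1 ∧ Nat.card (cyclicPart p x) = n} =
        (Finset.univ.filter fun x : PGL(2, F) =>
          x ≠ 1 ∧ Nat.card (cyclicPart p x) = n).card := fun n => by
      rw [Nat.card_eq_fintype_card, Fintype.card_subtype]
    rw [hfil, hfil, hfil, Nat.card_eq_fintype_card, ← Finset.card_univ,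
      ← Finset.card_erase_add_one (Finset.mem_univ (1 : PGL(2, F))),
      ← Finset.card_union_of_disjoint, ← Finset.card_union_of_disjoint]
    · congr 2
      ext x
      simp only [Finset.mem_union, Finset.mem_filter, Finset.mem_univ, true_and, and_true,
        Finset.mem_erase]
      constructor
      · rintro ((h | h) | h) <;> exact h.1
      · intro hx
        rcases (htri x hx).2 with h | h | h
        · exact Or.inr ⟨hx, h.1⟩
        · exact Or.inl (Or.inl ⟨hx, h.1⟩)
        · exact Or.inl (Or.inr ⟨hx, h.1⟩)
    · rw [Finset.disjoint_left]
      intro x hx hx'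
      simp only [Finset.mem_union, Finset.mem_filter, Finset.mem_univ, true_and] at hx hx'
      rcases hx with hx | hx <;> omega
    · rw [Finset.disjoint_left]
      intro x hx hx'
      simp only [Finset.mem_filter, Finset.mem_univ, true_and] at hx hx'
      omega
  have h0 := hcount 0
  have h1 := hcount 1
  have h2 := hcount 2
  simp only [Fin.isValue, Matrix.cons_val_zero, Matrix.cons_val_one, Matrix.cons_val] at h0 h1 h2
  refine ⟨fun Z => Z.1, τ, ?_, fun Z => (hτ Z _).1 rfl, ?_, ?_, ?_⟩
  · rintro ⟨_, x, hx, rfl⟩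
    exact (htri x hx).1
  · have hs := two_mul_card_isSplit (F := F)
    rw [← hsplit, ← h0, hF] at hs
    rw [← h0, ← h1, hunip, card_PGL, hF] at htotal
    rw [hunip] at h2
    set m₀ := Nat.card {i : ι // τ i = 0}
    set m₁ := Nat.card {i : ι // τ i = 1}
    have hm₀ : m₀ * 2 = q * (q + 1) := by
      refine Nat.eq_of_mul_eq_mul_right (by omega : 0 < q - 2) ?_
      rw [show q - 1 - 1 = q - 2 by omega] at hs
      calc m₀ * 2 * (q - 2) = 2 * (m₀ * (q - 2)) := by ring
        _ = (q ^ 2 + q) * (q - 2) := hs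
        _ = q * (q + 1) * (q - 2) := by ring
    -- This comes from `m₀(q - 2) + m₁q + (q² - 1) + 1 = q³ - q`; writing `q = r + 3` removes the
    -- truncated subtractions.
    have hm₁ : m₁ * 2 = q * (q - 1) := by
      refine Nat.eq_of_mul_eq_mul_right (by omega : 0 < q) ?_
      obtain ⟨r, rfl⟩ : ∃ r, q = r + 3 := ⟨q - 3, by omega⟩
      have e1 : (r + 3) ^ 2 = (r ^ 2 + 6 * r + 8) + 1 := by ring
      have e2 : (r + 3) ^ 3 = (r + 3) * (r ^ 2 + 6 * r + 8) + (r + 3) := by ring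
      rw [e1, e2, Nat.add_sub_cancel, Nat.add_sub_cancel, Nat.add_sub_cancel,
        show r + 3 - 1 - 1 = r + 1 by omega] at htotal
      rw [show r + 3 - 1 = r + 2 by omega]
      nlinarith
    intro k
    fin_cases k
    · exact (Nat.div_eq_of_eq_mul_left two_pos hm₀.symm).symm
    · exact (Nat.div_eq_of_eq_mul_left two_pos hm₁.symm).symm
    · exact (Nat.div_eq_of_eq_mul_left (by omega) h2.symm).symm
  · intro g hg
    exact ⟨⟨_, g, hg, rfl⟩, hmem g hg⟩
  · rintro g hg ⟨_, x, hx, rfl⟩ ⟨_, y, hy, rfl⟩ hgx hgy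
    exact Subtype.ext ((heq x hx g hgx hg).symm.trans (heq y hy g hgy hg))

end Partition

/-! ### Rearranging disjoint unions and assembling the final graph. -/

theorem Isomorphic.refl {V : Type*} (G : Digraph V) : Isomorphic G G := ⟨RelIso.refl _⟩

theorem Isomorphic.trans {U V W : Type*} {G : Digraph U} {H : Digraph V} {K : Digraph W}
    (h : Isomorphic G H) (h' : Isomorphic H K) : Isomorphic G K :=
  ⟨h.some.trans h'.some⟩

theorem Isomorphic.disjSum {U V U' V' : Type*} {G : Digraph U} {H : Digraph V} {G' : Digraph U'}
    {H' : Digraph V'} (h : Isomorphic G G') (h' : Isomorphic H H') :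
    Isomorphic (disjSum G H) (disjSum G' H') := by
  obtain ⟨e⟩ := h
  obtain ⟨e'⟩ := h'
  refine ⟨⟨Equiv.sumCongr e.toEquiv e'.toEquiv, ?_⟩⟩
  rintro (x | x) (y | y) <;> simp [PowerMapGraph.disjSum, e.map_rel_iff, e'.map_rel_iff]

theorem unionAdj_iff {ι : Type*} {V : ι → Type*} {G : (i : ι) → Digraph (V i)} {i : ι}
    {x y : V i} : UnionAdj G ⟨i, x⟩ ⟨i, y⟩ ↔ (G i).Adj x y := by
  constructor
  · rintro ⟨_, _, _, h⟩
    exact h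
  · exact fun h => ⟨_, _, _, h⟩

theorem UnionAdj.fst_eq {ι : Type*} {V : ι → Type*} {G : (i : ι) → Digraph (V i)}
    {x y : Σ i, V i} (h : UnionAdj G x y) : x.1 = y.1 := by
  cases h
  rfl

theorem isomorphic_disjUnion_fin_three {V : Fin 3 → Type*} {W : Type*}
    (G : (k : Fin 3) → Digraph (V k)) (C : Digraph W) :
    Isomorphic (disjSum (disjUnion G) C)
      (disjSum (disjSum (G 0) (G 1)) (disjSum (G 2) C)) := by
  let f : (V 0 ⊕ V 1) ⊕ (V 2 ⊕ W) → (Σ k, V k) ⊕ W :=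
    Sum.elim (Sum.elim (fun x => Sum.inl ⟨0, x⟩) fun x => Sum.inl ⟨1, x⟩)
      (Sum.elim (fun x => Sum.inl ⟨2, x⟩) Sum.inr)
  have hf : Function.Bijective f := by
    constructor
    · rintro ((x | x) | (x | x)) ((y | y) | (y | y)) h <;> simp [f] at h <;> simp [h]
    · rintro (⟨k, x⟩ | x)
      · fin_cases k
        · exact ⟨Sum.inl (Sum.inl x), rfl⟩
        · exact ⟨Sum.inl (Sum.inr x), rfl⟩
        · exact ⟨Sum.inr (Sum.inl x), rfl⟩
      · exact ⟨Sum.inr (Sum.inr x), rfl⟩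
  have hadj : ∀ x y, (disjSum (disjUnion G) C).Adj (f x) (f y) ↔
      (disjSum (disjSum (G 0) (G 1)) (disjSum (G 2) C)).Adj x y := by
    rintro ((x | x) | (x | x)) ((y | y) | (y | y)) <;>
      simp only [f, disjSum, disjUnion, Sum.elim_inl, Sum.elim_inr, Sum.liftRel_inl_inl,
        Sum.liftRel_inr_inr, Sum.not_liftRel_inl_inr, Sum.not_liftRel_inr_inl, unionAdj_iff,
        iff_false] <;>
      exact fun h => absurd h.fst_eq (by simp)
  exact ⟨(RelIso.mk (Equiv.ofBijective f hf) (hadj _ _)).symm⟩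

theorem isomorphic_disjSum_of_isEmpty {V W : Type*} [IsEmpty V] (G : Digraph V) (C : Digraph W) :
    Isomorphic (disjSum G C) C := by
  refine ⟨RelIso.symm ⟨(Equiv.emptySum V W).symm, ?_⟩⟩
  intro x y
  simp [disjSum]

theorem isomorphic_cycleFamily_one_disjSum (c t : ℕ) (T : RTree) {W : Type*} (C : Digraph W) :
    Isomorphic (disjSum (cycleFamily c 1 t T) C) C := by
  have : IsEmpty {d : ℕ // d ∣ 1 ∧ d ≠ 1} := ⟨fun d => d.2.2 (Nat.dvd_one.1 d.2.1)⟩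
  exact isomorphic_disjSum_of_isEmpty _ _

theorem isomorphic_disjUnion_of_unique {ι : Type*} [Unique ι] {V : ι → Type*}
    (G : (i : ι) → Digraph (V i)) : Isomorphic (disjUnion G) (G default) :=
  ⟨RelIso.symm ⟨(Equiv.uniqueSigma V).symm, unionAdj_iff⟩⟩

/-- The only divisor of `p` other than `1` is `p` itself, with `φ(p) = p - 1`. -/
theorem isomorphic_cycleFamily_prime (c p t N : ℕ) (T : RTree) (hp : p.Prime)
    (hN : c * (p - 1) = N) :
    Isomorphic (cycleFamily c p t T) (copies (N / ord p t) (Cyc (ord p t) T)) := by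
  let _ : Unique {d : ℕ // d ∣ p ∧ d ≠ 1} :=
    { default := ⟨p, dvd_rfl, hp.one_lt.ne'⟩
      uniq := fun d => Subtype.ext (((Nat.dvd_prime hp).1 d.2.1).resolve_left d.2.2) }
  have h := isomorphic_disjUnion_of_unique fun d : {d : ℕ // d ∣ p ∧ d ≠ 1} =>
    copies (c * Nat.totient d / ord d t) (Cyc (ord d t) T)
  rw [← hN, ← Nat.totient_prime hp]
  exact h

theorem coe_forest_smul (k : ℕ) (T : RTree) :
    ((k • T).forest : Multiset RTree) = k • (T.forest : Multiset RTree) := by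
  change (((List.replicate k T.forest).flatten : List RTree) : Multiset RTree) = _
  induction k with
  | zero => simp
  | succ k ih => rw [List.replicate_succ, List.flatten_cons, ← Multiset.coe_add, ih, succ_nsmul']

theorem coe_forest_add (S T : RTree) :
    ((S + T).forest : Multiset RTree) = (S.forest : Multiset RTree) + (T.forest : Multiset RTree) :=
  rfl

/-- Here a single step sends the whole group of order `p` to the identity, leaving a trivial
periodic part. -/
theorem isKernelSeq_prime_of_dvd {p t : ℕ} (hp : p.Prime) (h : p ∣ t) :
    IsKernelSeq t p 1 [p] where
  pos := hp.pos
  length_pos := by simp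
  getD_eq := by
    intro i hi
    obtain rfl : i = 0 := by simpa using hi
    exact (Nat.gcd_eq_right h).symm
  iterate_eq := by
    change p / Nat.gcd t p = 1
    rw [Nat.gcd_eq_right h, Nat.div_self hp.pos]
  coprime := Nat.coprime_one_right t

/-- Here the power map is already bijective, and the elementary tree of `[1]` is a single vertex. -/
theorem isKernelSeq_of_coprime {n t : ℕ} (hn : 0 < n) (h : Nat.Coprime t n) :
    IsKernelSeq t n n [1] where
  pos := hn
  length_pos := by simp
  getD_eq := by
    intro i hi
    obtain rfl : i = 0 := by simpa using hi
    exact (Nat.Coprime.gcd_eq_one h).symm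
  iterate_eq := by
    change n / Nat.gcd t n = n
    rw [h.gcd_eq_one, Nat.div_one]
  coprime := h

end PowerMapGraph

theorem mainTheorem10 (p s q t : ℕ) (hp : p.Prime) (hq : q = p ^ s) (hq4 : 4 ≤ q) (ht : 0 < t)
    (F : Type*) [Field F] (hF : Nat.card F = q)
    (ν₁ ω₁ ν₂ ω₂ : ℕ)
    (h₁ : q - 1 = ν₁ * ω₁) (hω₁ : IsGreatest {d : ℕ | d ∣ q - 1 ∧ Nat.Coprime d t} ω₁)
    (h₂ : q + 1 = ν₂ * ω₂) (hω₂ : IsGreatest {d : ℕ | d ∣ q + 1 ∧ Nat.Coprime d t} ω₂)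
    (d₁ d₂ : ℕ) (hd₁ : d₁ = q * (q + 1) / 2) (hd₂ : d₂ = q * (q - 1) / 2)
    (T₁ T₂ : PowerMapGraph.RTree)
    (hT₁ : T₁ = PowerMapGraph.RTree.elementary (PowerMapGraph.iteratedGcd t ν₁))
    (hT₂ : T₂ = PowerMapGraph.RTree.elementary (PowerMapGraph.iteratedGcd t ν₂)) :
    (p ∣ t →
      PowerMapGraph.Isomorphic
        (PowerMapGraph.functionalGraph fun g : PGL(2, F) => g ^ t)
        (PowerMapGraph.disjSum
          (PowerMapGraph.disjSum
            (PowerMapGraph.cycleFamily d₁ ω₁ t T₁)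
            (PowerMapGraph.cycleFamily d₂ ω₂ t T₂))
          (PowerMapGraph.Cyc 1
            (d₁ • T₁ + d₂ • T₂ +
              ((q ^ 2 - 1) / (p - 1)) • PowerMapGraph.RTree.elementary [p])))) ∧
    (¬ p ∣ t →
      PowerMapGraph.Isomorphic
        (PowerMapGraph.functionalGraph fun g : PGL(2, F) => g ^ t)
        (PowerMapGraph.disjSum
          (PowerMapGraph.disjSum
            (PowerMapGraph.cycleFamily d₁ ω₁ t T₁)
            (PowerMapGraph.cycleFamily d₂ ω₂ t T₂))
          (PowerMapGraph.disjSum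
            (PowerMapGraph.copies ((q ^ 2 - 1) / PowerMapGraph.ord p t)
              (PowerMapGraph.Cyc (PowerMapGraph.ord p t) PowerMapGraph.RTree.bullet))
            (PowerMapGraph.Cyc 1 (d₁ • T₁ + d₂ • T₂))))) := by
  have hpf : Fact p.Prime := ⟨hp⟩
  have hfin : Finite F := Nat.finite_of_card_ne_zero (by omega)
  have hs : s ≠ 0 := by
    rintro rfl
    simp at hq
    omega
  have hpq : p ∣ q := hq ▸ dvd_pow_self p hs
  have := Fintype.ofFinite F
  have hchar : CharP F p := charP_of_card_eq_prime_pow (f := s) (by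
    rw [← Nat.card_eq_fintype_card, hF, hq])
  obtain ⟨H, τ, hcyc, hn, hm, hcover, hdisj⟩ :=
    PowerMapGraph.exists_partition (F := F) p q hpq hF (by omega)
  rw [← hd₁, ← hd₂] at hm
  have hk₁ : PowerMapGraph.IsKernelSeq t (q - 1) ω₁ (PowerMapGraph.iteratedGcd t ν₁) :=
    PowerMapGraph.isKernelSeq_iteratedGcd (by omega) h₁ hω₁
  have hk₂ : PowerMapGraph.IsKernelSeq t (q + 1) ω₂ (PowerMapGraph.iteratedGcd t ν₂) :=
    PowerMapGraph.isKernelSeq_iteratedGcd (by omega) h₂ hω₂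
  -- As `q ^ 2` is a power of `p`, the division is exact.
  have hdvd : (q ^ 2 - 1) / (p - 1) * (p - 1) = q ^ 2 - 1 := by
    refine Nat.div_mul_cancel ?_
    rw [hq, ← pow_mul]
    simpa using Nat.sub_dvd_pow_sub_pow p 1 (s * 2)
  subst hT₁ hT₂
  constructor
  · intro hpt
    have key := PowerMapGraph.isomorphic_of_partition H hcyc τ
      ![d₁, d₂, (q ^ 2 - 1) / (p - 1)] ![q - 1, q + 1, p] ![ω₁, ω₂, 1]
      ![PowerMapGraph.iteratedGcd t ν₁, PowerMapGraph.iteratedGcd t ν₂, [p]] t hn hm hcover hdisj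
      (by
        intro k
        fin_cases k
        · exact hk₁
        · exact hk₂
        · exact PowerMapGraph.isKernelSeq_prime_of_dvd hp hpt)
      (d₁ • PowerMapGraph.RTree.elementary (PowerMapGraph.iteratedGcd t ν₁) +
        d₂ • PowerMapGraph.RTree.elementary (PowerMapGraph.iteratedGcd t ν₂) +
        ((q ^ 2 - 1) / (p - 1)) • PowerMapGraph.RTree.elementary [p])
      (by
        rw [Fin.sum_univ_three, PowerMapGraph.coe_forest_add, PowerMapGraph.coe_forest_add,
          PowerMapGraph.coe_forest_smul, PowerMapGraph.coe_forest_smul,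
          PowerMapGraph.coe_forest_smul]
        rfl)
    refine (key.trans (PowerMapGraph.isomorphic_disjUnion_fin_three _ _)).trans ?_
    refine (PowerMapGraph.Isomorphic.refl _).disjSum ?_
    exact PowerMapGraph.isomorphic_cycleFamily_one_disjSum _ t _ _
  · intro hpt
    have key := PowerMapGraph.isomorphic_of_partition H hcyc τ
      ![d₁, d₂, (q ^ 2 - 1) / (p - 1)] ![q - 1, q + 1, p] ![ω₁, ω₂, p]
      ![PowerMapGraph.iteratedGcd t ν₁, PowerMapGraph.iteratedGcd t ν₂, [1]] t hn hm hcover hdisj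
      (by
        intro k
        fin_cases k
        · exact hk₁
        · exact hk₂
        · exact PowerMapGraph.isKernelSeq_of_coprime hp.pos
            ((Nat.Prime.coprime_iff_not_dvd hp).2 hpt).symm)
      (d₁ • PowerMapGraph.RTree.elementary (PowerMapGraph.iteratedGcd t ν₁) +
        d₂ • PowerMapGraph.RTree.elementary (PowerMapGraph.iteratedGcd t ν₂))
      (by
        rw [Fin.sum_univ_three, PowerMapGraph.coe_forest_add, PowerMapGraph.coe_forest_smul,
          PowerMapGraph.coe_forest_smul]
        -- The elementary tree of `[1]` has an empty forest, so the subgroups of order `p` add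
        -- nothing at the identity.
        exact (add_zero _).symm.trans (congrArg _ (nsmul_zero _).symm))
    refine (key.trans (PowerMapGraph.isomorphic_disjUnion_fin_three _ _)).trans ?_
    refine (PowerMapGraph.Isomorphic.refl _).disjSum (PowerMapGraph.Isomorphic.disjSum ?_
      (PowerMapGraph.Isomorphic.refl _))
    exact PowerMapGraph.isomorphic_cycleFamily_prime _ p t _ _ hp hdvd
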